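/- Let $N\cong\mathbf Z^d$ be a lattice with dual lattice $M$, and let $\rho\subset N_{\mathbf R}$ be a rational polyhedral cone which is strictly convex and of dimension $d$. Let $\rho^\vee\subset M_{\mathbf R}$ be its dual cone and write $u\le_\rho u'$ if $u'-u\in\rho^\vee$. For a lattice $\Lambda\subset M_{\mathbf Q}$ let $\mathbf C\{\rho^\vee\cap\Lambda\}$ be the ring of convergent power series with exponents in $\rho^\vee\cap\Lambda$; "unit" means a series with non-zero constant term. A monic polynomial over $\mathbf C\{\rho^\vee\cap M\}$ is quasi-ordinary if its discriminant is $X^\eta\cdot$unit. Let $f\in\mathbf C\{\rho^\vee\cap M\}[Y]$ be an irreducible monic quasi-ordinary polynomial of degree $n$ whose non-leading coefficients have zero constant term, let $\zeta\in\mathbf C\{\rho^\vee\cap\frac1nM\}$ be a root of $f$, and let $R=\mathbf C\{\rho^\vee\cap M\}[\zeta]$ be the analytic algebra of the germ $S$ defined by $f$. Let $\lambda_1<_\rho\dots<_\rho\lambda_g$, with $g\ge1$, be the characteristic exponents of $f$, i.e. the exponents $\lambda$ with $\zeta'-\zeta''=X^{\lambda}\cdot$unit for two different roots $\zeta',\zeta''$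 of $f$ among the series with exponents in $\rho^\vee\cap\frac1mM$, $m\ge1$; put $\lambda_{g+1}=+\infty$. Let $M_0=M$, $M_j=M_{j-1}+\mathbf Z\lambda_j$, $n_0=1$, $n_j=\#M_j/M_{j-1}$, $\gamma_1=\lambda_1$ and $\gamma_{j+1}=n_j\gamma_j+\lambda_{j+1}-\lambda_j$. Let $q_0,\dots,q_g$ be a complete set of semi-roots of $f$: $q_j$ is a non-zero constant times an irreducible monic quasi-ordinary polynomial $p_j$ over $\mathbf C\{\rho^\vee\cap M\}$ of degree $n_0\cdots n_j$ having order of coincidence $\lambda_{j+1}$ with $f$ (for $j<g$ this means that $p_jf$ is quasi-ordinary and that $\lambda_{j+1}$ is the largest exponent $\lambda$ such that $\zeta'-\zeta''=X^\lambda\cdot$unit for a root $\zeta'$ of $p_j$ and a root $\zeta''$ of $f$; for $j=g$ it means $p_g=f$), the constants being such that for $j<g$ the coefficient of $X^{\gamma_{j+1}}$ in $q_j(\zeta)$ is $1$. Define the weight of a monomial $X^\alpha U_1^{v_1}\cdots U_g^{v_g}$ to be $\alpha+v_1\gamma_1+\dots+v_g\gamma_g$. Let $$\Psi_0:\mathbf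 C\{\rho^\vee\cap M\}[U_1,\dots,U_g]\to R,\qquad U_j\mapsto q_{j-1}(\zeta),$$ be the homomorphism of $\mathbf C\{\rho^\vee\cap M\}$-algebras which defines the embedding of $S$ in the toric variety $Z_\Delta$ of the cone $\Delta=\rho\oplus\mathbf R^g_{\ge0}$. Then $\Psi_0$ is surjective, and the ideal $\operatorname{Ker}\Psi_0$ of the embedding $S\subset Z_\Delta$ is generated by $g$ elements $$H_j=U_j^{n_j}-X^{\alpha^{(j)}}U_1^{l^{(j)}_1}\cdots U_{j-1}^{l^{(j)}_{j-1}}+c_j^*U_{j+1}+r_j(U_1,\dots,U_j),\qquad j=1,\dots,g,$$ of $\mathbf C\{\rho^\vee\cap M\}[U_1,\dots,U_g]$ (without the term $c_j^*U_{j+1}$ for $j=g$), where: - $\alpha^{(j)}\in\rho^\vee\cap M$, $0\le l^{(j)}_i<n_i$ and $n_j\gamma_j=\alpha^{(j)}+l^{(j)}_1\gamma_1+\dots+l^{(j)}_{j-1}\gamma_{j-1}$; - $c_j^*\in\mathbf C^*$ for $j=1,\dots,g$; - $r_j$ has degree $<n_i$ in $U_i$ for $1\le i\le j$, and every term of $r_j$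 has weight $>_\rho n_j\gamma_j$; - the terms of $r_j$ are those of the expansion in terms of semi-roots $$q_{j-1}^{n_j}=X^{\alpha^{(j)}}q_0^{l^{(j)}_1}\cdots q_{j-2}^{l^{(j)}_{j-1}}-c_j^*q_j-r_j(q_0,\dots,q_{j-1})\quad\text{in }\mathbf C\{\rho^\vee\cap M\}[Y].$$ Thus $H_j$ is a deformation of the binomial $h_j=U_j^{n_j}-X^{\alpha^{(j)}}U_1^{l^{(j)}_1}\cdots U_{j-1}^{l^{(j)}_{j-1}}$, which is homogeneous of weight $n_j\gamma_j$: every term of $H_j-h_j$ has weight $>_\rho n_j\gamma_j$. -/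

import Mathlib

open Polynomial

noncomputable section

namespace ToricQO

/-- A rational convex polyhedral cone `ρ` in `N_ℝ = ℝ^d`, for the lattice `N = ℤ^d`, which is
strictly convex and of dimension `d` (the latter means that the dual cone is strictly convex). -/
structure RationalCone (d : ℕ) where
  cone : PointedCone ℝ (Fin d → ℝ)
  rational : ∃ s : Finset (Fin d → ℤ),
    cone = PointedCone.hull ℝ ((fun a : Fin d → ℤ => fun i => (a i : ℝ)) '' (s : Set (Fin d → ℤ)))
  strictlyConvex : ∀ w ∈ cone, -w ∈ cone → w = 0
  fullDimensional : Submodule.span ℝ (cone : Set (Fin d → ℝ)) = ⊤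

/-- The real vector space `M_ℝ = ℝ^d` dual to `N_ℝ`, where the exponents of the series live.
The cone is recorded in the type because it determines the order on the exponents. -/
def Expo {d : ℕ} (_ρ : RationalCone d) : Type := Fin d → ℝ

variable {d : ℕ} {ρ : RationalCone d}

instance : AddCommGroup (Expo ρ) := inferInstanceAs (AddCommGroup (Fin d → ℝ))

/-- The duality pairing `⟨u, w⟩` of `u ∈ M_ℝ` and `w ∈ N_ℝ`. -/
def pairing (u : Expo ρ) (w : Fin d → ℝ) : ℝ := ∑ i, u i * w i

theorem pairing_zero (w : Fin d → ℝ) : pairing (0 : Expo ρ) w = 0 :=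
  Finset.sum_eq_zero fun i _ => zero_mul (w i)

theorem pairing_add (u v : Expo ρ) (w : Fin d → ℝ) :
    pairing (u + v) w = pairing u w + pairing v w := by
  unfold pairing
  rw [← Finset.sum_add_distrib]
  exact Finset.sum_congr rfl fun i _ => add_mul (u i) (v i) (w i)

theorem pairing_sub (u v : Expo ρ) (w : Fin d → ℝ) :
    pairing (u - v) w = pairing u w - pairing v w := by
  have h := pairing_add (u - v) v w
  rw [sub_add_cancel] at h
  linarith

theorem pairing_add_right (u : Expo ρ) (w w' : Fin d → ℝ) :
    pairing u (w + w') = pairing u w + pairing u w' := by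
  unfold pairing
  rw [← Finset.sum_add_distrib]
  exact Finset.sum_congr rfl fun i _ => mul_add (u i) (w i) (w' i)

theorem eq_zero_of_pairing (u : Expo ρ) (h : ∀ w ∈ ρ.cone, pairing u w = 0) : u = 0 := by
  let L : (Fin d → ℝ) →ₗ[ℝ] ℝ :=
    { toFun := fun w => pairing u w
      map_add' := pairing_add_right u
      map_smul' := fun c w => by
        simp only [pairing, Pi.smul_apply, smul_eq_mul, RingHom.id_apply, Finset.mul_sum]
        exact Finset.sum_congr rfl fun i _ => by ring }
  have hL : (⊤ : Submodule ℝ (Fin d → ℝ)) ≤ LinearMap.ker L := by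
    rw [← ρ.fullDimensional, Submodule.span_le]
    exact fun w hw => h w hw
  funext i
  have hi : L (Pi.single i 1) = 0 := hL (Submodule.mem_top)
  have hs : L (Pi.single i 1) = u i := by
    change ∑ k, u k * (Pi.single i 1 : Fin d → ℝ) k = u i
    rw [Finset.sum_eq_single i (fun k _ hk => by simp [hk]) (fun h => absurd (Finset.mem_univ i) h)]
    simp
  exact hs.symm.trans hi

/-- The dual cone `ρ^∨ = {u ∈ M_ℝ : ⟨u, w⟩ ≥ 0 for all w ∈ ρ}`. -/
def dualCone (ρ : RationalCone d) : AddSubmonoid (Expo ρ) where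
  carrier := {u | ∀ w ∈ ρ.cone, 0 ≤ pairing u w}
  zero_mem' := fun w _ => (pairing_zero w).ge
  add_mem' := fun {u v} hu hv w hw => by
    rw [pairing_add]
    exact add_nonneg (hu w hw) (hv w hw)

/-- The partial order `u ≤_ρ u' ↔ u' ∈ u + ρ^∨`. -/
instance : PartialOrder (Expo ρ) where
  le u v := v - u ∈ dualCone ρ
  le_refl u := by
    rw [sub_self]
    exact (dualCone ρ).zero_mem
  le_trans u v w huv hvw := by
    have h := (dualCone ρ).add_mem hvw huv
    rwa [sub_add_sub_cancel] at h
  le_antisymm u v huv hvu := by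
    refine (sub_eq_zero.mp (eq_zero_of_pairing (v - u) fun w hw => ?_)).symm
    have h1 := huv w hw
    have h2 := hvu w hw
    rw [pairing_sub] at h1 h2 ⊢
    linarith

instance : IsOrderedAddMonoid (Expo ρ) where
  add_le_add_left u v huv w := by
    change v + w - (u + w) ∈ dualCone ρ
    rw [add_sub_add_right_eq_sub]
    exact huv

/-- The lattice `(1/m) M` in `M_ℝ`, where `M = ℤ^d` (used for `m ≥ 1` only). -/
def fracLattice (ρ : RationalCone d) (m : ℕ) : AddSubgroup (Expo ρ) where
  carrier := {u | ∀ i, ∃ k : ℤ, (m : ℝ) * u i = k}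
  zero_mem' := fun i => ⟨0, by
    change (m : ℝ) * 0 = _
    simp⟩
  add_mem' := fun {u v} hu hv i => by
    obtain ⟨k, hk⟩ := hu i
    obtain ⟨l, hl⟩ := hv i
    refine ⟨k + l, ?_⟩
    change (m : ℝ) * (u i + v i) = _
    push_cast
    rw [mul_add, hk, hl]
  neg_mem' := fun {u} hu i => by
    obtain ⟨k, hk⟩ := hu i
    refine ⟨-k, ?_⟩
    change (m : ℝ) * (-(u i)) = _
    push_cast
    rw [mul_neg, hk]

/-- The lattice `M = ℤ^d`. -/
def latticeM (ρ : RationalCone d) : AddSubgroup (Expo ρ) := fracLattice ρ 1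

/-- The semigroup `ρ^∨ ∩ Λ` of a lattice `Λ`. -/
def semigroup (ρ : RationalCone d) (Λ : AddSubgroup (Expo ρ)) : AddSubmonoid (Expo ρ) :=
  dualCone ρ ⊓ Λ.toAddSubmonoid

/-- The ambient ring of formal series `∑ c_u X^u` with complex coefficients and exponents in `M_ℝ`
(supports partially well ordered for `≤_ρ`; if `Λ` is a lattice `(1/m) M` then every subset of
`ρ^∨ ∩ Λ` is so). -/
abbrev Series (ρ : RationalCone d) : Type := HahnSeries (Expo ρ) ℂ

/-- `∑ |c_u| e^{-⟨u, w⟩} < ∞`. -/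
def ConvergesAt (x : Series ρ) (w : Fin d → ℝ) : Prop :=
  Summable fun u : Expo ρ => ‖x.coeff u‖ * Real.exp (-pairing u w)

theorem ConvergesAt.add_right {x : Series ρ} {w w' : Fin d → ℝ}
    (hx : ∀ u ∈ x.support, u ∈ dualCone ρ) (h : ConvergesAt x w) (hw' : w' ∈ ρ.cone) :
    ConvergesAt x (w + w') := by
  refine Summable.of_nonneg_of_le (fun u => by positivity) (fun u => ?_) h
  by_cases hu : x.coeff u = 0
  · simp [hu]
  · have h1 : 0 ≤ pairing u w' := hx u hu w' hw'
    rw [pairing_add_right]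
    gcongr
    linarith

theorem ConvergesAt.add {x y : Series ρ} {w : Fin d → ℝ}
    (hx : ConvergesAt x w) (hy : ConvergesAt y w) : ConvergesAt (x + y) w := by
  refine Summable.of_nonneg_of_le (fun u => by positivity) (fun u => ?_) (Summable.add hx hy)
  rw [HahnSeries.coeff_add, ← add_mul]
  gcongr
  exact norm_add_le _ _

theorem ConvergesAt.mul {x y : Series ρ} {w : Fin d → ℝ}
    (hx : ConvergesAt x w) (hy : ConvergesAt y w) : ConvergesAt (x * y) w := by
  classical
  have hxy := Summable.mul_of_nonneg hx hy (fun u => by positivity) (fun u => by positivity)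
  refine summable_of_sum_le (fun u => by positivity)
    (c := ∑' p : Expo ρ × Expo ρ, ‖x.coeff p.1‖ * Real.exp (-pairing p.1 w) *
      (‖y.coeff p.2‖ * Real.exp (-pairing p.2 w))) fun s => ?_
  refine le_trans ?_ (hxy.sum_le_tsum
    (s.biUnion fun a => Finset.antidiagonal x.isPWO_support y.isPWO_support a)
    (fun p _ => by positivity))
  rw [Finset.sum_biUnion]
  · refine Finset.sum_le_sum fun a _ => ?_
    rw [HahnSeries.coeff_mul]
    refine le_trans (mul_le_mul_of_nonneg_right (norm_sum_le _ _) (Real.exp_pos _).le) ?_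
    rw [Finset.sum_mul]
    refine Finset.sum_le_sum fun p hp => le_of_eq ?_
    have hp' : p.1 + p.2 = a := (Finset.mem_antidiagonal.mp hp).2.2
    rw [← hp', pairing_add, norm_mul, neg_add, Real.exp_add]
    ring
  · intro a _ b _ hab
    refine Finset.disjoint_left.mpr fun p hp hq => hab ?_
    rw [← (Finset.mem_antidiagonal.mp hp).2.2, ← (Finset.mem_antidiagonal.mp hq).2.2]

theorem convergesAt_single (u : Expo ρ) (c : ℂ) (w : Fin d → ℝ) :
    ConvergesAt (HahnSeries.single u c : Series ρ) w := by
  refine summable_of_ne_finset_zero (s := {u}) fun v hv => ?_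
  rw [HahnSeries.coeff_single_of_ne (by simpa using hv)]
  simp

/-- The ring `ℂ{ρ^∨ ∩ Λ}`: the series with exponents in `ρ^∨ ∩ Λ` such that
`∑ |c_u| e^{-⟨u, w⟩} < ∞` for some `w ∈ ρ`, that is, such that the series converges absolutely and
uniformly on the neighbourhood `{|X^u| ≤ e^{-⟨u, w⟩} for all u ∈ ρ^∨ ∩ Λ}` of the `0`-dimensional
orbit of the affine toric variety `Spec ℂ[ρ^∨ ∩ Λ]`. -/
def convSeries (ρ : RationalCone d) (Λ : AddSubgroup (Expo ρ)) : Subalgebra ℂ (Series ρ) where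
  carrier := {x | (∀ u ∈ x.support, u ∈ semigroup ρ Λ) ∧ ∃ w ∈ ρ.cone, ConvergesAt x w}
  add_mem' := fun {x y} ⟨hx, w, hw, hxw⟩ ⟨hy, w', hw', hyw⟩ => by
    refine ⟨fun u hu => ?_, w + w', ρ.cone.add_mem hw hw',
      (hxw.add_right (fun u hu => (hx u hu).1) hw').add ?_⟩
    · rcases HahnSeries.support_add_subset _ _ hu with h | h
      · exact hx u h
      · exact hy u h
    · rw [add_comm w w']
      exact hyw.add_right (fun u hu => (hy u hu).1) hw
  mul_mem' := fun {x y} ⟨hx, w, hw, hxw⟩ ⟨hy, w', hw', hyw⟩ => by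
    refine ⟨fun u hu => ?_, w + w', ρ.cone.add_mem hw hw',
      (hxw.add_right (fun u hu => (hx u hu).1) hw').mul ?_⟩
    · obtain ⟨a, ha, b, hb, rfl⟩ := HahnSeries.support_mul_subset hu
      exact (semigroup ρ Λ).add_mem (hx a ha) (hy b hb)
    · rw [add_comm w w']
      exact hyw.add_right (fun u hu => (hy u hu).1) hw
  algebraMap_mem' := fun c => by
    refine ⟨fun u hu => ?_, 0, ρ.cone.zero_mem, convergesAt_single 0 c 0⟩
    have h : u ∈ ({0} : Set (Expo ρ)) := HahnSeries.support_single_subset hu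
    rw [Set.mem_singleton_iff.mp h]
    exact (semigroup ρ Λ).zero_mem

instance (Λ : AddSubgroup (Expo ρ)) : CommRing (convSeries ρ Λ) :=
  Subalgebra.toCommRing (convSeries ρ Λ)

instance (Λ : AddSubgroup (Expo ρ)) : Algebra (convSeries ρ Λ) (Series ρ) :=
  Subalgebra.toAlgebra (convSeries ρ Λ)

/-- The monomial `X^u` for `u ∈ ρ^∨ ∩ Λ`. -/
def toricMonomial {Λ : AddSubgroup (Expo ρ)} (u : semigroup ρ Λ) : convSeries ρ Λ :=
  ⟨HahnSeries.single (u : Expo ρ) 1, fun v hv => by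
      have h : v ∈ ({(u : Expo ρ)} : Set (Expo ρ)) := HahnSeries.support_single_subset hv
      rw [Set.mem_singleton_iff.mp h]
      exact u.2,
    0, ρ.cone.zero_mem, convergesAt_single _ _ _⟩

/-- The base ring `ℂ{ρ^∨ ∩ M}`. -/
abbrev BaseRing (ρ : RationalCone d) : Type := convSeries ρ (latticeM ρ)

/-- The fractional series: elements of `ℂ{ρ^∨ ∩ (1/m) M}` for some `m ≥ 1`. -/
def IsFractional (x : Series ρ) : Prop := ∃ m : ℕ, 0 < m ∧ x ∈ convSeries ρ (fracLattice ρ m)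

/-- `x = X^u · H` with `H` a fractional series that does not vanish at the origin `o_ρ`
(that is, `H` is a unit of some `ℂ{ρ^∨ ∩ (1/m) M}`). -/
def IsMonomialTimesUnit (x : Series ρ) (u : Expo ρ) : Prop :=
  ∃ H : Series ρ, IsFractional H ∧ H.coeff 0 ≠ 0 ∧ x = HahnSeries.single u 1 * H

/-- `p ∈ ℂ{ρ^∨ ∩ M}[Y]` is quasi-ordinary: its discriminant is `X^η · H` with
`H ∈ ℂ{ρ^∨ ∩ M}`, `H(o_ρ) ≠ 0`. -/
def IsQuasiOrdinary (p : (BaseRing ρ)[X]) : Prop :=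
  ∃ (η : semigroup ρ (latticeM ρ)) (H : BaseRing ρ),
    (H : Series ρ).coeff 0 ≠ 0 ∧ p.discr = toricMonomial η * H

/-- The roots of `p` among the fractional series. -/
def branches (p : (BaseRing ρ)[X]) : Set (Series ρ) := {z | IsFractional z ∧ aeval z p = 0}

/-- The characteristic exponents of `p`: the exponents `λ` such that `ζ - ζ' = X^λ · unit` for two
different roots of `p`. -/
def charExponents (p : (BaseRing ρ)[X]) : Set (Expo ρ) :=
  {u | ∃ z ∈ branches p, ∃ z' ∈ branches p, z ≠ z' ∧ IsMonomialTimesUnit (z - z') u}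

/-- The order of coincidence of two irreducible quasi-ordinary monic polynomials is `e`.
It is `+∞` for `p = p'`; it is `u` if `p p'` is quasi-ordinary and `u` is the largest exponent of
the differences of a root of `p` and a root of `p'`. -/
def HasOrderOfCoincidence (p p' : (BaseRing ρ)[X]) : WithTop (Expo ρ) → Prop
  | ⊤ => p = p'
  | (u : Expo ρ) => IsQuasiOrdinary (p * p') ∧
      IsGreatest {v | ∃ z ∈ branches p, ∃ z' ∈ branches p', IsMonomialTimesUnit (z - z') v} u

section Characteristic

/- In this section `lam 1, …, lam g` are the characteristic exponents `λ_1 < ⋯ < λ_g`. -/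

/-- The lattice `M_k = M + ℤ λ_1 + ⋯ + ℤ λ_k`. -/
def charLattice (lam : ℕ → Expo ρ) (k : ℕ) : AddSubgroup (Expo ρ) :=
  latticeM ρ ⊔ AddSubgroup.closure (lam '' Set.Icc 1 k)

/-- The integer `n_k = # M_k / M_{k-1}` for `k ≥ 1`, and `n_0 = 1`. -/
def charInt (lam : ℕ → Expo ρ) (k : ℕ) : ℕ :=
  (charLattice lam (k - 1)).relIndex (charLattice lam k)

/-- `γ_1 = λ_1` and `γ_{j+1} = n_j γ_j + λ_{j+1} - λ_j` (the value at `0` is not used). -/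
def gam (lam : ℕ → Expo ρ) : ℕ → Expo ρ
  | 0 => 0
  | 1 => lam 1
  | (j + 2) => charInt lam (j + 1) • gam lam (j + 1) + lam (j + 2) - lam (j + 1)

/-- `f` is an irreducible quasi-ordinary monic polynomial with `f(o_ρ, Y) = Y^{deg f}`, with root
`ζ ∈ ℂ{ρ^∨ ∩ (1/n) M}`, `n = deg f`, and `λ_1 < ⋯ < λ_g` are its characteristic exponents. -/
structure IsBranch (f : (BaseRing ρ)[X]) (ζ : Series ρ) (g : ℕ) (lam : ℕ → Expo ρ) : Prop where
  monic : f.Monic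
  irreducible : Irreducible f
  quasiOrdinary : IsQuasiOrdinary f
  at_origin : ∀ i < f.natDegree, ((f.coeff i : BaseRing ρ) : Series ρ).coeff 0 = 0
  mem : ζ ∈ convSeries ρ (fracLattice ρ f.natDegree)
  root : aeval ζ f = 0
  strictMono : StrictMonoOn lam (Set.Icc 1 g)
  charExponents_eq : lam '' Set.Icc 1 g = charExponents f

/-- `p` is a (monic) `j`-th semi-root of `f`: an irreducible quasi-ordinary polynomial of degree
`n_0 ⋯ n_j` which has order of coincidence `λ_{j+1}` with `f`, where `λ_{g+1} = +∞`. -/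
structure IsSemiRoot (f : (BaseRing ρ)[X]) (g : ℕ) (lam : ℕ → Expo ρ) (j : ℕ)
    (p : (BaseRing ρ)[X]) : Prop where
  monic : p.Monic
  irreducible : Irreducible p
  quasiOrdinary : IsQuasiOrdinary p
  natDegree_eq : p.natDegree = ∏ k ∈ Finset.range (j + 1), charInt lam k
  coincidence : HasOrderOfCoincidence p f
    (if j + 1 ≤ g then ((lam (j + 1) : Expo ρ) : WithTop (Expo ρ)) else ⊤)

/-- `q_0, …, q_g` is a complete set of semi-roots of `f`, where `q_j`, for `j < g`, is multiplied
by a constant so that the coefficient of `X^{γ_{j+1}}` in `q_j(ζ)` is equal to one. -/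
structure IsNormalizedSemiRoots (f : (BaseRing ρ)[X]) (ζ : Series ρ) (g : ℕ) (lam : ℕ → Expo ρ)
    (q : Fin (g + 1) → (BaseRing ρ)[X]) : Prop where
  semiRoot : ∀ j : Fin (g + 1), ∃ (a : ℂ) (p : (BaseRing ρ)[X]),
    a ≠ 0 ∧ IsSemiRoot f g lam j p ∧ q j = Polynomial.C (algebraMap ℂ (BaseRing ρ) a) * p
  normalized : ∀ j : Fin g, (aeval ζ (q j.castSucc) : Series ρ).coeff (gam lam (j + 1)) = 1

end Characteristic

/-- The analytic algebra `R = ℂ{ρ^∨ ∩ M}[ζ]`. -/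
abbrev branchAlgebra (ζ : Series ρ) : Subalgebra (BaseRing ρ) (Series ρ) :=
  Algebra.adjoin (BaseRing ρ) {ζ}

instance (ζ : Series ρ) : CommRing (branchAlgebra ζ) :=
  Subalgebra.toCommRing (branchAlgebra ζ)

instance (ζ : Series ρ) : Algebra (BaseRing ρ) (branchAlgebra ζ) :=
  Subalgebra.algebra (branchAlgebra ζ)

/-- The homomorphism `Ψ_0 : ℂ{ρ^∨ ∩ M}[U_1, …, U_g] → R`, `U_j ↦ q_{j-1}(ζ)`. The variable `U_j` is
`MvPolynomial.X` at the index `j - 1` of `Fin g`. -/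
def embeddingHom (ζ : Series ρ) {g : ℕ} (q : Fin (g + 1) → (BaseRing ρ)[X]) :
    MvPolynomial (Fin g) (BaseRing ρ) →ₐ[BaseRing ρ] branchAlgebra ζ :=
  MvPolynomial.aeval fun j : Fin g =>
    ⟨aeval ζ (q j.castSucc), Polynomial.aeval_mem_adjoin_singleton _ _⟩

/-- The weight `α + v_1 γ_1 + ⋯ + v_g γ_g` of the monomial `X^α U^v`. -/
def weight (lam : ℕ → Expo ρ) {g : ℕ} (α : Expo ρ) (v : Fin g →₀ ℕ) : Expo ρ :=
  α + ∑ i : Fin g, v i • gam lam (i + 1)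

/-- Every term `X^α U^v` of `P` has weight `>_ρ w`. -/
def TermsWeightGT (lam : ℕ → Expo ρ) {g : ℕ} (P : MvPolynomial (Fin g) (BaseRing ρ))
    (w : Expo ρ) : Prop :=
  ∀ (v : Fin g →₀ ℕ) (α : Expo ρ), ((P.coeff v : BaseRing ρ) : Series ρ).coeff α ≠ 0 →
    w < weight lam α v

/-- The binomial `U_{j}^{n_{j}} - X^{α} U^{l}` (index shifted by one). -/
def binom (lam : ℕ → Expo ρ) {g : ℕ} (j : Fin g) (α : semigroup ρ (latticeM ρ))
    (l : Fin g →₀ ℕ) : MvPolynomial (Fin g) (BaseRing ρ) :=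
  MvPolynomial.X j ^ charInt lam (j + 1) - MvPolynomial.monomial l (toricMonomial α)

/-- The term `c U_{j+1}`, which is absent for `j = g` (index shifted by one). -/
def linearTerm {g : ℕ} (j : Fin g) (c : ℂ) : MvPolynomial (Fin g) (BaseRing ρ) :=
  if h : (j : ℕ) + 1 < g then
    MvPolynomial.C (algebraMap ℂ (BaseRing ρ) c) * MvPolynomial.X ⟨j + 1, h⟩
  else 0

end ToricQO

end

/-! The proof rests on two facts: the values of the semi-roots at `ζ` are monomials times units, and
reduced monomials in these values have distinct weights.

Values. For Λ = (1/m)M, the finite group G of unit-circle characters of Λ trivial on M acts on ℂ{ρ^∨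
∩ Λ} by rescaling monomials, with invariant ring ℂ{ρ^∨ ∩ M}. Hence an irreducible monic polynomial
with a root in this ring is the product of Y - y' over the G-orbit of that root
(`map_eq_prodXSubSMul`). Differences of roots of `f` divide its discriminant, so they are monomials
times units, and their exponents are the λ_i. If y is a root of a semi-root p_j with contact λ_{j+1}
with ζ, the exponent of ζ - χy is determined by the largest k ≤ j with χ trivial on M_k. Summing
over χ and comparing with the degree of p_j gives p_j(ζ) = X^{γ_{j+1}} · unit
(`isLeast_aeval_semiRoot`).

Weights. Since γ_k ≡ λ_k modulo M_{k-1} and λ_k generates the cyclic group M_k/M_{k-1} of order n_k,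
a monomial X^α U^v with v_i < n_i is determined by its weight (`eq_of_weight_eq`). The terms of
least weight in a reduced polynomial therefore cannot cancel after U_i ↦ q_{i-1}(ζ). A suitable
combination q_{j-1}^{n_j} + c q_j has degree below that of q_j and expands in q_0, …, q_{j-1}. Its
value at ζ starts with X^{n_jγ_j}, with coefficient one, so exactly one term of the expansion has
weight n_jγ_j and all others are heavier (`exists_relation`).

Kernel. Modulo the H_j, the relations identify the class of U_{j+1} with that of q_j, successively
in j, because the c_j are units; the last one makes q_g, that is `f` up to a constant, vanish. If
P(q_0(ζ), …, q_{g-1}(ζ)) = 0, then `f` divides P(q_0, …, q_{g-1}), so P lies in the ideal of the H_j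
(`mem_span_of_relations`). -/

namespace ToricQO

/-! ### Linear refinements of the order and initial exponents -/

variable {d : ℕ} {ρ : RationalCone d}

theorem le_iff_pairing {u v : Expo ρ} :
    u ≤ v ↔ ∀ w ∈ ρ.cone, pairing u w ≤ pairing v w := by
  refine forall₂_congr fun w _ => ?_
  rw [pairing_sub, sub_nonneg]

/-- An injective monotone homomorphism from the exponents to a linearly ordered group refines the
order `≤_ρ` to a linear order. -/
theorem exists_linear_refinement (w : Fin d → ℝ) (hw : w ∈ ρ.cone) :
    ∃ (k : ℕ) (φ : Expo ρ →+ Lex (Fin (k + 1) → ℝ)), Function.Injective φ ∧ Monotone φ ∧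
      ∀ u v, φ u ≤ φ v → pairing u w ≤ pairing v w := by
  obtain ⟨s, hs⟩ := ρ.rational
  let e := s.equivFin
  -- Exponents are compared lexicographically by their pairings with `w` and then with generators of
  -- the cone. Putting `w` first makes the linear order refine the comparison of ⟨·, w⟩.
  let W : Fin (s.card + 1) → Fin d → ℝ :=
    Fin.cons w fun i => fun a => ((e.symm i : Fin d → ℤ) a : ℝ)
  have hW : ∀ i, W i ∈ ρ.cone := by
    intro i
    refine Fin.cases hw (fun i => ?_) i
    rw [hs]
    exact Submodule.subset_span ⟨_, (e.symm i).2, rfl⟩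
  refine ⟨s.card,
    { toFun := fun u => toLex fun i => pairing u (W i)
      map_zero' := congrArg toLex (funext fun i => pairing_zero (W i))
      map_add' := fun u v => congrArg toLex (funext fun i => pairing_add u v (W i)) }, ?_, ?_, ?_⟩
  · rw [injective_iff_map_eq_zero]
    intro u hu
    have hu' : ∀ i, pairing u (W i) = 0 := fun i => congrFun hu i
    refine eq_zero_of_pairing u fun v hv => ?_
    let L : (Fin d → ℝ) →ₗ[ℝ] ℝ :=
      { toFun := fun w => pairing u w
        map_add' := pairing_add_right u
        map_smul' := fun c w => by
          simp only [pairing, Pi.smul_apply, smul_eq_mul, RingHom.id_apply, Finset.mul_sum]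
          exact Finset.sum_congr rfl fun i _ => by ring }
    -- Vanishing on the generators gives vanishing on the cone, whose span is the whole space.
    have hle : ρ.cone ≤ (LinearMap.ker L).restrictScalars {c : ℝ // 0 ≤ c} := by
      rw [hs]
      refine Submodule.span_le.mpr ?_
      rintro _ ⟨a, ha, rfl⟩
      have := hu' (e ⟨a, ha⟩).succ
      simpa [W, L] using this
    exact hle hv
  · intro u v huv
    exact Pi.toLex_monotone fun i => le_iff_pairing.mp huv _ (hW i)
  · intro u v huv
    have := Pi.apply_le_of_toLex (i := 0) huv (fun j hj => absurd hj (Fin.not_lt_zero j))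
    simpa [W] using this

section Leading

variable {L : Type*} [AddCommGroup L] [LinearOrder L]

/-- `a` is the least exponent of `x` for the linear order obtained from `φ`. -/
def IsLeading (φ : Expo ρ →+ L) (x : Series ρ) (a : Expo ρ) : Prop :=
  x.coeff a ≠ 0 ∧ ∀ u, x.coeff u ≠ 0 → φ a ≤ φ u

/-- Only one pair of exponents contributes to the convolution. This serves both for leading
exponents of a linear refinement and for least exponents of `≤_ρ`. -/
theorem coeff_mul_add_of_unique {x y : Series ρ} {a b : Expo ρ}
    (h : ∀ u v, x.coeff u ≠ 0 → y.coeff v ≠ 0 → u + v = a + b → u = a) :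
    (x * y).coeff (a + b) = x.coeff a * y.coeff b := by
  classical
  rw [HahnSeries.coeff_mul]
  refine Finset.sum_eq_single (a, b) (fun p hp hne => ?_) fun hn => ?_
  · obtain ⟨h1, h2, h3⟩ := Finset.mem_antidiagonal.mp hp
    have h4 := h p.1 p.2 h1 h2 h3
    refine absurd (Prod.ext h4 ?_) hne
    rw [h4] at h3
    exact add_left_cancel h3
  · by_contra hne
    exact hn (Finset.mem_antidiagonal.mpr
      ⟨left_ne_zero_of_mul hne, right_ne_zero_of_mul hne, rfl⟩)

theorem exists_add_of_coeff_mul_ne_zero {x y : Series ρ} {u : Expo ρ} (h : (x * y).coeff u ≠ 0) :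
    ∃ a b, x.coeff a ≠ 0 ∧ y.coeff b ≠ 0 ∧ a + b = u := by
  obtain ⟨a, ha, b, hb, hab⟩ := HahnSeries.support_mul_subset (show u ∈ (x * y).support from h)
  exact ⟨a, b, ha, hb, hab⟩

theorem exists_isLeading {φ : Expo ρ →+ L} (hφ : Monotone φ) {x : Series ρ} (hx : x ≠ 0) :
    ∃ a, IsLeading φ x a := by
  have hpwo : (φ '' x.support).IsPWO := x.isPWO_support.image_of_monotone hφ
  have hne : (φ '' x.support).Nonempty := (HahnSeries.support_nonempty_iff.mpr hx).image _
  obtain ⟨a, ha, hmin⟩ := hpwo.isWF.min_mem hne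
  refine ⟨a, ha, fun u hu => ?_⟩
  rw [hmin]
  exact hpwo.isWF.min_le hne (Set.mem_image_of_mem _ hu)

theorem IsLeading.unique {φ : Expo ρ →+ L} (hinj : Function.Injective φ) {x : Series ρ}
    {a b : Expo ρ} (ha : IsLeading φ x a) (hb : IsLeading φ x b) : a = b :=
  hinj (le_antisymm (ha.2 b hb.1) (hb.2 a ha.1))

theorem IsLeading.coeff_mul [IsOrderedAddMonoid L] {φ : Expo ρ →+ L} (hinj : Function.Injective φ) {x y : Series ρ}
    {a b : Expo ρ} (ha : IsLeading φ x a) (hb : IsLeading φ y b) :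
    (x * y).coeff (a + b) = x.coeff a * y.coeff b := by
  refine coeff_mul_add_of_unique fun u v hu hv huv => hinj (le_antisymm ?_ (ha.2 u hu))
  have h1 := hb.2 v hv
  have h2 : φ u + φ v = φ a + φ b := by rw [← map_add, huv, map_add]
  by_contra h3
  exact (add_lt_add_of_lt_of_le (not_le.mp h3) h1).ne h2.symm

theorem IsLeading.mul [IsOrderedAddMonoid L] {φ : Expo ρ →+ L} (hinj : Function.Injective φ) {x y : Series ρ}
    {a b : Expo ρ} (ha : IsLeading φ x a) (hb : IsLeading φ y b) :
    IsLeading φ (x * y) (a + b) := by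
  refine ⟨?_, fun u hu => ?_⟩
  · rw [ha.coeff_mul hinj hb]
    exact mul_ne_zero ha.1 hb.1
  · obtain ⟨s, t, hs, ht, rfl⟩ := exists_add_of_coeff_mul_ne_zero hu
    rw [map_add, map_add]
    exact add_le_add (ha.2 s hs) (hb.2 t ht)

theorem isLeading_of_isLeast {φ : Expo ρ →+ L} (hφ : Monotone φ) {x : Series ρ} {a : Expo ρ}
    (h : IsLeast x.support a) : IsLeading φ x a :=
  ⟨h.1, fun _ hu => hφ (h.2 hu)⟩

end Leading

/-- The exponents are only partially ordered, but leading terms for any linear refinement multiply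
without cancellation. -/
instance : NoZeroDivisors (Series ρ) where
  eq_zero_or_eq_zero_of_mul_eq_zero {x y} hxy := by
    by_contra! h
    obtain ⟨k, φ, hinj, hmono, -⟩ := exists_linear_refinement (ρ := ρ) 0 ρ.cone.zero_mem
    obtain ⟨a, ha⟩ := exists_isLeading hmono h.1
    obtain ⟨b, hb⟩ := exists_isLeading hmono h.2
    exact (ha.mul hinj hb).1 (by rw [hxy]; rfl)

instance : IsDomain (Series ρ) := NoZeroDivisors.to_isDomain _

theorem coeff_mul_of_isLeast {x y : Series ρ} {a b : Expo ρ} (ha : IsLeast x.support a)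
    (hb : IsLeast y.support b) : (x * y).coeff (a + b) = x.coeff a * y.coeff b := by
  refine coeff_mul_add_of_unique fun u v hu hv huv => ?_
  refine le_antisymm ?_ (ha.2 hu)
  have h1 : b ≤ v := hb.2 hv
  rw [eq_sub_of_add_eq huv]
  exact sub_le_iff_le_add.mpr (by gcongr)

theorem isLeast_mul {x y : Series ρ} {a b : Expo ρ} (ha : IsLeast x.support a)
    (hb : IsLeast y.support b) : IsLeast (x * y).support (a + b) := by
  refine ⟨?_, fun u hu => ?_⟩
  · rw [HahnSeries.mem_support, coeff_mul_of_isLeast ha hb]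
    exact mul_ne_zero ha.1 hb.1
  · obtain ⟨s, t, hs, ht, rfl⟩ := exists_add_of_coeff_mul_ne_zero hu
    exact add_le_add (ha.2 hs) (hb.2 ht)

theorem isLeast_prod {ι : Type*} (s : Finset ι) {x : ι → Series ρ} {a : ι → Expo ρ}
    (h : ∀ i ∈ s, IsLeast (x i).support (a i)) :
    IsLeast (∏ i ∈ s, x i).support (∑ i ∈ s, a i) := by
  classical
  induction s using Finset.induction_on with
  | empty => simp
  | insert i s hi ih =>
    rw [Finset.prod_insert hi, Finset.sum_insert hi]
    exact isLeast_mul (h i (Finset.mem_insert_self i s))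
      (ih fun k hk => h k (Finset.mem_insert_of_mem hk))

theorem coeff_prod_of_isLeast {ι : Type*} (s : Finset ι) {x : ι → Series ρ} {a : ι → Expo ρ}
    (h : ∀ i ∈ s, IsLeast (x i).support (a i)) :
    (∏ i ∈ s, x i).coeff (∑ i ∈ s, a i) = ∏ i ∈ s, (x i).coeff (a i) := by
  classical
  induction s using Finset.induction_on with
  | empty => simp
  | insert i s hi ih =>
    rw [Finset.prod_insert hi, Finset.sum_insert hi, Finset.prod_insert hi]
    have h' : ∀ k ∈ s, IsLeast (x k).support (a k) :=
      fun k hk => h k (Finset.mem_insert_of_mem hk)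
    rw [coeff_mul_of_isLeast (h i (Finset.mem_insert_self i s)) (isLeast_prod s h'), ih h']

theorem isLeast_pow {x : Series ρ} {a : Expo ρ} (h : IsLeast x.support a) (n : ℕ) :
    IsLeast (x ^ n).support (n • a) := by
  simpa using isLeast_prod (Finset.range n) (fun _ _ => h)

theorem coeff_pow_of_isLeast {x : Series ρ} {a : Expo ρ} (h : IsLeast x.support a) (n : ℕ) :
    (x ^ n).coeff (n • a) = x.coeff a ^ n := by
  simpa using coeff_prod_of_isLeast (Finset.range n) (fun _ _ => h)

/-- If a product is a monomial times a unit, then so is each factor. -/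
theorem exists_isLeast_of_mul {x y : Series ρ} {c : Expo ρ} (h : IsLeast (x * y).support c) :
    ∃ a, IsLeast x.support a := by
  have hxy : x * y ≠ 0 := fun h0 => h.1 (by rw [h0]; rfl)
  have hx := left_ne_zero_of_mul hxy
  have hy := right_ne_zero_of_mul hxy
  obtain ⟨k, φ, hinj, hmono, -⟩ := exists_linear_refinement (ρ := ρ) 0 ρ.cone.zero_mem
  obtain ⟨a, ha⟩ := exists_isLeading hmono hx
  obtain ⟨b, hb⟩ := exists_isLeading hmono hy
  have hab : a + b = c := (ha.mul hinj hb).unique hinj (isLeading_of_isLeast hmono h)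
  -- For each `w`, a refinement starting with `w` yields leading exponents `a'`, `b'` minimizing ⟨·,
  -- w⟩, again with sum `c`. From ⟨a', w⟩ ≤ ⟨a, w⟩, ⟨b', w⟩ ≤ ⟨b, w⟩ and equal sums, `a` minimizes
  -- ⟨·, w⟩ as well. Geometrically, a Newton polyhedron is a translate of `ρ^∨` only if its
  -- Minkowski summands are.
  refine ⟨a, ha.1, fun u hu => le_iff_pairing.mpr fun w hw => ?_⟩
  obtain ⟨k', ψ, hinj', hmono', hψ⟩ := exists_linear_refinement w hw
  obtain ⟨a', ha'⟩ := exists_isLeading hmono' hx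
  obtain ⟨b', hb'⟩ := exists_isLeading hmono' hy
  have hab' : a' + b' = c := (ha'.mul hinj' hb').unique hinj' (isLeading_of_isLeast hmono' h)
  have h1 := hψ _ _ (ha'.2 a ha.1)
  have h2 := hψ _ _ (hb'.2 b hb.1)
  have h3 := hψ _ _ (ha'.2 u hu)
  have h4 : pairing a w + pairing b w = pairing a' w + pairing b' w := by
    rw [← pairing_add, ← pairing_add, hab, hab']
  linarith

theorem isLeast_add_of_lt {x y : Series ρ} {a b : Expo ρ} (ha : IsLeast x.support a)
    (hb : IsLeast y.support b) (hab : a < b) : IsLeast (x + y).support a := by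
  refine ⟨?_, fun u hu => ?_⟩
  · have : y.coeff a = 0 := by
      by_contra h
      exact (hb.2 h).not_gt hab
    rw [HahnSeries.mem_support, HahnSeries.coeff_add, this, add_zero]
    exact ha.1
  · rcases HahnSeries.support_add_subset _ _ hu with h | h
    · exact ha.2 h
    · exact hab.le.trans (hb.2 h)

theorem isLeast_of_isMonomialTimesUnit {x : Series ρ} {u : Expo ρ} (h : IsMonomialTimesUnit x u) :
    IsLeast x.support u := by
  obtain ⟨H, ⟨m, -, hH⟩, h0, rfl⟩ := h
  have h1 : IsLeast H.support 0 := ⟨h0, fun v hv => by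
    have := (hH.1 v hv).1
    change v - 0 ∈ dualCone ρ
    rwa [sub_zero]⟩
  have h2 : IsLeast (HahnSeries.single u (1 : ℂ) : Series ρ).support u := by
    rw [HahnSeries.support_single_of_ne one_ne_zero]
    exact isLeast_singleton
  simpa using isLeast_mul h2 h1

/-- Division by `X^u` moves the support into `ρ^∨` exactly because `u` is least, and it preserves
convergence at `w`. So "monomial times unit" becomes a condition on the support alone. -/
theorem isMonomialTimesUnit_of_isLeast {x : Series ρ} {u : Expo ρ} {m : ℕ} (hm : 0 < m)
    (hx : x ∈ convSeries ρ (fracLattice ρ m)) (h : IsLeast x.support u) :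
    IsMonomialTimesUnit x u := by
  obtain ⟨hsupp, w, hw, hconv⟩ := hx
  have hcoeff : ∀ v, (HahnSeries.single (-u) (1 : ℂ) * x : Series ρ).coeff v = x.coeff (u + v) := by
    intro v
    have := HahnSeries.coeff_single_mul_add (r := (1 : ℂ)) (x := x) (a := u + v) (b := -u)
    simpa using this
  refine ⟨HahnSeries.single (-u) 1 * x, ⟨m, hm, fun v hv => ?_, w, hw, ?_⟩, ?_, ?_⟩
  · rw [HahnSeries.mem_support, hcoeff] at hv
    refine ⟨?_, ?_⟩
    · have : u ≤ u + v := h.2 hv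
      change u + v - u ∈ dualCone ρ at this
      rwa [add_sub_cancel_left] at this
    · have := (fracLattice ρ m).sub_mem (hsupp _ hv).2 (hsupp _ h.1).2
      rwa [add_sub_cancel_left] at this
  · have h1 : ConvergesAt (HahnSeries.single (-u) (1 : ℂ) : Series ρ) w := convergesAt_single _ _ _
    exact h1.mul hconv
  · rw [hcoeff, add_zero]
    exact h.1
  · rw [← mul_assoc, HahnSeries.single_mul_single]
    simp

end ToricQO

/-! ### Characters of lattices and their action on series -/

namespace ToricQO

section Characters

variable {E : Type*} [AddCommGroup E]

/-- The characters of `Λ` which are trivial on `Λ ∩ L`. -/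
def annihilator (Λ L : AddSubgroup E) : Subgroup (AddChar Λ Circle) where
  carrier := {χ | ∀ u : Λ, (u : E) ∈ L → χ u = 1}
  one_mem' := fun _ _ => rfl
  mul_mem' := fun {χ ψ} hχ hψ u hu => by rw [AddChar.mul_apply, hχ u hu, hψ u hu, one_mul]
  inv_mem' := fun {χ} hχ u hu => by
    rw [AddChar.inv_apply', hχ u hu, inv_one]

/-- Composition with the projection identifies the characters of `Λ / L` with the characters of
`Λ` which are trivial on `L`. -/
theorem quotient_character_bijective (Λ L : AddSubgroup E) :
    Function.Bijective fun ψ : AddChar (Λ ⧸ L.addSubgroupOf Λ) Circle =>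
      (⟨ψ.compAddMonoidHom (QuotientAddGroup.mk' (L.addSubgroupOf Λ)), fun u hu => by
        rw [AddChar.compAddMonoidHom_apply, QuotientAddGroup.mk'_apply,
          (QuotientAddGroup.eq_zero_iff u).mpr (AddSubgroup.mem_addSubgroupOf.mpr hu),
          AddChar.map_zero_eq_one]⟩ : annihilator Λ L) := by
  refine ⟨fun ψ ψ' h => ?_, fun χ => ?_⟩
  · exact AddChar.compAddMonoidHom_injective_left _ (QuotientAddGroup.mk'_surjective _)
      (congrArg Subtype.val h)
  · let F : Λ ⧸ L.addSubgroupOf Λ →+ Additive Circle :=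
      QuotientAddGroup.lift _ χ.1.toAddMonoidHom fun u hu =>
        χ.2 u (AddSubgroup.mem_addSubgroupOf.mp hu)
    refine ⟨AddChar.toAddMonoidHomEquiv.symm F, Subtype.ext ?_⟩
    ext u
    rfl

theorem finite_quotient_of_relIndex_ne_zero {Λ L : AddSubgroup E} (h : L.relIndex Λ ≠ 0) :
    Finite (Λ ⧸ L.addSubgroupOf Λ) :=
  AddSubgroup.index_ne_zero_iff_finite.mp h

/-- These are the characters of the finite group Λ/(Λ ∩ L), which has as many characters as
elements. -/
theorem card_annihilator {Λ L : AddSubgroup E} (h : L.relIndex Λ ≠ 0) :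
    Nat.card (annihilator Λ L) = L.relIndex Λ := by
  have := finite_quotient_of_relIndex_ne_zero h
  have := Fintype.ofFinite (Λ ⧸ L.addSubgroupOf Λ)
  rw [← Nat.card_congr (Equiv.ofBijective _ (quotient_character_bijective Λ L)),
    Nat.card_congr AddChar.circleEquivComplex.toEquiv, Nat.card_eq_fintype_card, AddChar.card_eq,
    ← Nat.card_eq_fintype_card]
  rfl

theorem finite_annihilator {Λ L : AddSubgroup E} (h : L.relIndex Λ ≠ 0) :
    Finite (annihilator Λ L) :=
  Nat.finite_of_card_ne_zero (by rwa [card_annihilator h])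

theorem exists_mem_annihilator_ne_one {Λ L : AddSubgroup E} (h : L.relIndex Λ ≠ 0) (u : Λ)
    (hu : (u : E) ∉ L) : ∃ χ ∈ annihilator Λ L, χ u ≠ 1 := by
  have := finite_quotient_of_relIndex_ne_zero h
  have hne : (QuotientAddGroup.mk u : Λ ⧸ L.addSubgroupOf Λ) ≠ 0 := fun h0 =>
    hu (AddSubgroup.mem_addSubgroupOf.mp ((QuotientAddGroup.eq_zero_iff u).mp h0))
  obtain ⟨ψ, hψ⟩ := AddChar.exists_apply_ne_zero.mpr hne
  let χ := (Equiv.ofBijective _ (quotient_character_bijective Λ L))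
    (AddChar.circleEquivComplex.symm ψ)
  refine ⟨χ.1, χ.2, fun h1 => hψ ?_⟩
  exact congrArg (fun z : Circle => (z : ℂ)) h1

end Characters

variable {d : ℕ} {ρ : RationalCone d}

/-- Multiplication by `m` followed by reduction modulo `m` maps (1/m)M to the finite group (ℤ/m)^d,
with kernel inside M. -/
theorem relIndex_latticeM_ne_zero {m : ℕ} (hm : 0 < m) :
    (latticeM ρ).relIndex (fracLattice ρ m) ≠ 0 := by
  have : NeZero m := ⟨hm.ne'⟩
  have hm' : (m : ℝ) ≠ 0 := Nat.cast_ne_zero.mpr hm.ne'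
  have hfl : ∀ u : fracLattice ρ m, ∀ i, (⌊(m : ℝ) * (u : Expo ρ) i⌋ : ℝ) = m * (u : Expo ρ) i := by
    intro u i
    obtain ⟨k, hk⟩ := u.2 i
    rw [hk, Int.floor_intCast]
  let F : fracLattice ρ m →+ (Fin d → ZMod m) :=
    AddMonoidHom.mk' (fun u i => ((⌊(m : ℝ) * (u : Expo ρ) i⌋ : ℤ) : ZMod m)) fun u v => by
      funext i
      have : ⌊(m : ℝ) * ((u + v : fracLattice ρ m) : Expo ρ) i⌋ =
          ⌊(m : ℝ) * (u : Expo ρ) i⌋ + ⌊(m : ℝ) * (v : Expo ρ) i⌋ := by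
        have h : ((⌊(m : ℝ) * ((u + v : fracLattice ρ m) : Expo ρ) i⌋ : ℤ) : ℝ) =
            (⌊(m : ℝ) * (u : Expo ρ) i⌋ : ℝ) + ⌊(m : ℝ) * (v : Expo ρ) i⌋ := by
          rw [hfl, hfl, hfl]
          exact mul_add _ _ _
        exact_mod_cast h
      rw [this, Pi.add_apply]
      push_cast
      rfl
  have hle : F.ker ≤ (latticeM ρ).addSubgroupOf (fracLattice ρ m) := by
    intro u hu i
    have h1 : ((⌊(m : ℝ) * (u : Expo ρ) i⌋ : ℤ) : ZMod m) = 0 := congrFun hu i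
    obtain ⟨k, hk⟩ := (ZMod.intCast_zmod_eq_zero_iff_dvd _ m).mp h1
    refine ⟨k, ?_⟩
    have h2 := hfl u i
    rw [hk] at h2
    push_cast at h2
    have h3 := mul_left_cancel₀ hm' h2
    rw [h3, Nat.cast_one, one_mul]
    rfl
  exact (AddSubgroup.finiteIndex_of_le hle).index_ne_zero

theorem fracLattice_le_of_dvd {m k : ℕ} (h : m ∣ k) : fracLattice ρ m ≤ fracLattice ρ k := by
  obtain ⟨c, rfl⟩ := h
  intro u hu i
  obtain ⟨a, ha⟩ := hu i
  refine ⟨c * a, ?_⟩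
  push_cast
  rw [← ha]
  ring

theorem latticeM_le {m : ℕ} : latticeM ρ ≤ fracLattice ρ m :=
  fracLattice_le_of_dvd (one_dvd m)

theorem convSeries_mono {Λ Λ' : AddSubgroup (Expo ρ)} (h : Λ ≤ Λ') :
    convSeries ρ Λ ≤ convSeries ρ Λ' :=
  fun _ hx => ⟨fun u hu => ⟨(hx.1 u hu).1, h (hx.1 u hu).2⟩, hx.2⟩

section Twist

variable {Λ : AddSubgroup (Expo ρ)}

open Classical in
/-- The extension of a character of `Λ` by the value `1`. -/
noncomputable def extendOne (χ : AddChar Λ Circle) (u : Expo ρ) : Circle :=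
  if h : u ∈ Λ then χ ⟨u, h⟩ else 1

theorem extendOne_of_mem (χ : AddChar Λ Circle) {u : Expo ρ} (h : u ∈ Λ) :
    extendOne χ u = χ ⟨u, h⟩ := dif_pos h

theorem extendOne_add (χ : AddChar Λ Circle) {u v : Expo ρ} (hu : u ∈ Λ) (hv : v ∈ Λ) :
    extendOne χ (u + v) = extendOne χ u * extendOne χ v := by
  rw [extendOne_of_mem χ hu, extendOne_of_mem χ hv, extendOne_of_mem χ (Λ.add_mem hu hv),
    ← AddChar.map_add_eq_mul]
  rfl

/-- The series `∑ χ(u) c_u X^u`. -/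
noncomputable def twist (χ : AddChar Λ Circle) (x : Series ρ) : Series ρ where
  coeff u := extendOne χ u * x.coeff u
  isPWO_support' := x.isPWO_support.mono fun _ hu => right_ne_zero_of_mul hu

theorem coeff_twist (χ : AddChar Λ Circle) (x : Series ρ) (u : Expo ρ) :
    (twist χ x).coeff u = extendOne χ u * x.coeff u := rfl

theorem support_twist (χ : AddChar Λ Circle) (x : Series ρ) :
    (twist χ x).support = x.support := by
  ext u
  simp [coeff_twist]

theorem twist_mul (χ : AddChar Λ Circle) {x y : Series ρ} (hx : ∀ u ∈ x.support, u ∈ Λ)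
    (hy : ∀ u ∈ y.support, u ∈ Λ) : twist χ (x * y) = twist χ x * twist χ y := by
  ext u
  rw [coeff_twist, HahnSeries.coeff_mul, HahnSeries.coeff_mul, Finset.mul_sum]
  refine Finset.sum_congr (by ext; simp [support_twist]) fun p hp => ?_
  obtain ⟨h1, h2, h3⟩ := Finset.mem_antidiagonal.mp hp
  rw [support_twist] at h1 h2
  rw [← h3, extendOne_add χ (hx _ h1) (hy _ h2), coeff_twist, coeff_twist]
  push_cast
  ring

/-- The characters of `Λ` act on `ℂ{ρ^∨ ∩ Λ}`. -/
noncomputable instance : MulSemiringAction (AddChar Λ Circle) (convSeries ρ Λ) where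
  smul χ x := ⟨twist χ x, fun u hu => x.2.1 u (by rwa [support_twist] at hu), by
    obtain ⟨w, hw, h⟩ := x.2.2
    refine ⟨w, hw, ?_⟩
    -- Character values have modulus one, so the twisted series converges absolutely at the same
    -- `w`.
    refine h.congr fun u => ?_
    rw [coeff_twist, norm_mul, Circle.norm_coe, one_mul]⟩
  one_smul x := Subtype.ext <| by
    ext u
    change (extendOne (1 : AddChar Λ Circle) u : ℂ) * _ = _
    simp [extendOne]
  mul_smul χ ψ x := Subtype.ext <| by
    ext u
    change (extendOne (χ * ψ) u : ℂ) * _ = extendOne χ u * (extendOne ψ u * _)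
    have : extendOne (χ * ψ) u = extendOne χ u * extendOne ψ u := by
      unfold extendOne
      split_ifs
      · rfl
      · exact (one_mul _).symm
    rw [this, Circle.coe_mul, mul_assoc]
  smul_zero χ := Subtype.ext <| by
    ext u
    exact mul_zero _
  smul_add χ x y := Subtype.ext <| by
    ext u
    exact mul_add _ _ _
  smul_one χ := Subtype.ext <| by
    ext u
    change (extendOne χ u : ℂ) * (1 : Series ρ).coeff u = (1 : Series ρ).coeff u
    rw [HahnSeries.coeff_one]
    split_ifs with h
    · rw [h, extendOne_of_mem χ Λ.zero_mem]
      have : χ ⟨0, Λ.zero_mem⟩ = 1 := χ.map_zero_eq_one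
      simp [this]
    · simp
  smul_mul χ x y := Subtype.ext <|
    twist_mul χ (fun u hu => (x.2.1 u hu).2) fun u hu => (y.2.1 u hu).2

theorem coe_smul (χ : AddChar Λ Circle) (x : convSeries ρ Λ) :
    ((χ • x : convSeries ρ Λ) : Series ρ) = twist χ x := rfl

theorem coeff_smul_of_mem (χ : AddChar Λ Circle) (x : convSeries ρ Λ) {u : Expo ρ} (hu : u ∈ Λ) :
    ((χ • x : convSeries ρ Λ) : Series ρ).coeff u = χ ⟨u, hu⟩ * (x : Series ρ).coeff u := by
  rw [coe_smul, coeff_twist, extendOne_of_mem χ hu]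

theorem support_smul_eq (χ : AddChar Λ Circle) (x : convSeries ρ Λ) :
    ((χ • x : convSeries ρ Λ) : Series ρ).support = (x : Series ρ).support :=
  support_twist χ _

theorem smul_eq_self_iff (χ : AddChar Λ Circle) (x : convSeries ρ Λ) :
    χ • x = x ↔ ∀ u : Λ, (x : Series ρ).coeff u ≠ 0 → χ u = 1 := by
  constructor
  · intro h u hu
    have h1 := coeff_smul_of_mem χ x u.2
    rw [h] at h1
    have h2 : ((χ u : Circle) : ℂ) = 1 := (mul_eq_right₀ hu).mp h1.symm
    exact Circle.coe_eq_one.mp h2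
  · intro h
    refine Subtype.ext (HahnSeries.ext (funext fun u => ?_))
    by_cases hu : (x : Series ρ).coeff u = 0
    · rw [coe_smul, coeff_twist, hu, mul_zero]
    · have hmem := (x.2.1 u hu).2
      rw [coeff_smul_of_mem χ x hmem, h ⟨u, hmem⟩ hu, Circle.coe_one, one_mul]

/-- The invariants of the characters which are trivial on `L` are the series with exponents
in `L`. -/
theorem mem_convSeries_of_forall_smul_eq {L : AddSubgroup (Expo ρ)} (hL : L.relIndex Λ ≠ 0)
    (x : convSeries ρ Λ) (h : ∀ χ ∈ annihilator Λ L, χ • x = x) :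
    (x : Series ρ) ∈ convSeries ρ L := by
  refine ⟨fun u hu => ⟨(x.2.1 u hu).1, ?_⟩, x.2.2⟩
  -- Characters separate the points of Λ/(Λ ∩ L), so an exponent outside `L` would be moved by one
  -- of them.
  by_contra hn
  obtain ⟨χ, hχ, hne⟩ := exists_mem_annihilator_ne_one hL ⟨u, (x.2.1 u hu).2⟩ hn
  exact hne ((smul_eq_self_iff χ x).mp (h χ hχ) _ hu)

end Twist

end ToricQO

/-! ### Roots of irreducible polynomials as orbits of characters -/

namespace ToricQO

variable {d : ℕ} {ρ : RationalCone d}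

section Orbit

variable {Λ : AddSubgroup (Expo ρ)}

/-- The inclusion `ℂ{ρ^∨ ∩ M} → ℂ{ρ^∨ ∩ Λ}` for a lattice `Λ` containing `M`. -/
noncomputable def baseInclusion (hM : latticeM ρ ≤ Λ) : BaseRing ρ →+* convSeries ρ Λ :=
  (Subalgebra.inclusion (convSeries_mono hM)).toRingHom

theorem coe_baseInclusion (hM : latticeM ρ ≤ Λ) (x : BaseRing ρ) :
    (baseInclusion hM x : Series ρ) = x := rfl

theorem baseInclusion_injective (hM : latticeM ρ ≤ Λ) : Function.Injective (baseInclusion hM) :=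
  Subalgebra.inclusion_injective _

theorem smul_baseInclusion (hM : latticeM ρ ≤ Λ) {χ : AddChar Λ Circle}
    (hχ : χ ∈ annihilator Λ (latticeM ρ)) (x : BaseRing ρ) :
    χ • baseInclusion hM x = baseInclusion hM x :=
  (smul_eq_self_iff χ _).mpr fun u hu => hχ u (x.2.1 u hu).2

theorem coe_eval_map (hM : latticeM ρ ≤ Λ) (p : (BaseRing ρ)[X]) (x : convSeries ρ Λ) :
    (((p.map (baseInclusion hM)).eval x : convSeries ρ Λ) : Series ρ) = aeval (x : Series ρ) p := by
  rw [eval_map, aeval_def]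
  exact hom_eval₂ p (baseInclusion hM) (convSeries ρ Λ).val.toRingHom x

theorem eval_map_eq_zero_iff (hM : latticeM ρ ≤ Λ) (p : (BaseRing ρ)[X]) (x : convSeries ρ Λ) :
    (p.map (baseInclusion hM)).eval x = 0 ↔ aeval (x : Series ρ) p = 0 := by
  rw [← coe_eval_map hM]
  exact (ZeroMemClass.coe_eq_zero).symm

theorem eval_map_smul (hM : latticeM ρ ≤ Λ) {χ : AddChar Λ Circle}
    (hχ : χ ∈ annihilator Λ (latticeM ρ)) (p : (BaseRing ρ)[X]) (x : convSeries ρ Λ) :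
    (p.map (baseInclusion hM)).eval (χ • x) = χ • (p.map (baseInclusion hM)).eval x := by
  rw [eval_map, eval_map, eval₂_eq_sum_range, eval₂_eq_sum_range, Finset.smul_sum]
  refine Finset.sum_congr rfl fun i _ => ?_
  rw [smul_mul', smul_pow', smul_baseInclusion hM hχ]

variable [Fintype (annihilator Λ (latticeM ρ))]

theorem prodXSubSMul_eq_prod (x : convSeries ρ Λ) [Fintype
      (annihilator Λ (latticeM ρ) ⧸ MulAction.stabilizer (annihilator Λ (latticeM ρ)) x)] :
    prodXSubSMul (annihilator Λ (latticeM ρ)) (convSeries ρ Λ) x =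
      ∏ g : annihilator Λ (latticeM ρ) ⧸ MulAction.stabilizer (annihilator Λ (latticeM ρ)) x,
        (X - C (MulAction.ofQuotientStabilizer _ x g)) :=
  Finset.prod_congr (Finset.ext fun _ => by simp) fun _ _ => rfl

/-- The coefficients of `Q` are invariant, so all conjugates of `x` are roots. The orbit lists them
without repetition and the ring is a domain. -/
theorem prodXSubSMul_dvd (hM : latticeM ρ ≤ Λ) {x : convSeries ρ Λ} {Q : (BaseRing ρ)[X]}
    (h : aeval (x : Series ρ) Q = 0) :
    prodXSubSMul (annihilator Λ (latticeM ρ)) (convSeries ρ Λ) x ∣ Q.map (baseInclusion hM) := by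
  classical
  rcases eq_or_ne Q 0 with rfl | hQ
  · simp
  have hQ' : Q.map (baseInclusion hM) ≠ 0 :=
    (Polynomial.map_ne_zero_iff (baseInclusion_injective hM)).mpr hQ
  let s : Multiset (convSeries ρ Λ) := Finset.univ.val.map
    (MulAction.ofQuotientStabilizer (annihilator Λ (latticeM ρ)) x)
  have hs : prodXSubSMul (annihilator Λ (latticeM ρ)) (convSeries ρ Λ) x =
      (s.map fun a => X - C a).prod := by
    rw [Multiset.map_map, prodXSubSMul_eq_prod]
    rfl
  rw [hs, Multiset.prod_X_sub_C_dvd_iff_le_roots hQ', Multiset.le_iff_subset]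
  · intro a ha
    obtain ⟨g, -, rfl⟩ := Multiset.mem_map.mp ha
    rw [mem_roots hQ', IsRoot.def]
    induction g using QuotientGroup.induction_on with
    | H g =>
      rw [MulAction.ofQuotientStabilizer_mk]
      change (Q.map (baseInclusion hM)).eval (g.1 • x) = 0
      rw [eval_map_smul hM g.2, (eval_map_eq_zero_iff hM Q x).mpr h, smul_zero]
  · exact Finset.univ.nodup.map (MulAction.injective_ofQuotientStabilizer _ x)

/-- The coefficients of the orbit polynomial are invariant, and invariant series have exponents in
M. -/
theorem exists_map_eq_prodXSubSMul (hM : latticeM ρ ≤ Λ) (hi : (latticeM ρ).relIndex Λ ≠ 0)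
    (x : convSeries ρ Λ) : ∃ P : (BaseRing ρ)[X], P.Monic ∧ P.map (baseInclusion hM) =
      prodXSubSMul (annihilator Λ (latticeM ρ)) (convSeries ρ Λ) x := by
  have hl : prodXSubSMul (annihilator Λ (latticeM ρ)) (convSeries ρ Λ) x ∈
      lifts (baseInclusion hM) := by
    rw [lifts_iff_coeff_lifts]
    intro k
    refine ⟨⟨_, mem_convSeries_of_forall_smul_eq hi
      ((prodXSubSMul (annihilator Λ (latticeM ρ)) (convSeries ρ Λ) x).coeff k)
      fun χ hχ => prodXSubSMul.coeff _ _ x (⟨χ, hχ⟩ : annihilator Λ (latticeM ρ)) k⟩, rfl⟩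
  obtain ⟨P, hP, -, hmon⟩ := lifts_and_natDegree_eq_and_monic hl (prodXSubSMul.monic _ _ x)
  exact ⟨P, hmon, hP⟩

/-- An irreducible monic polynomial with root `x` is the product of the `Y - x'`, where `x'` runs
through the conjugates of `x`. -/
theorem map_eq_prodXSubSMul (hM : latticeM ρ ≤ Λ) (hi : (latticeM ρ).relIndex Λ ≠ 0)
    {x : convSeries ρ Λ} {p : (BaseRing ρ)[X]} (hmon : p.Monic) (hirr : Irreducible p)
    (hx : aeval (x : Series ρ) p = 0) : p.map (baseInclusion hM) =
      prodXSubSMul (annihilator Λ (latticeM ρ)) (convSeries ρ Λ) x := by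
  obtain ⟨P, hP, hPmap⟩ := exists_map_eq_prodXSubSMul hM hi x
  have hdvd : P ∣ p := by
    rw [← map_dvd_map (baseInclusion hM) (baseInclusion_injective hM) hP, hPmap]
    exact prodXSubSMul_dvd hM hx
  -- A monic unit is `1`, which does not vanish at `x`.
  have hnu : ¬ IsUnit P := by
    intro hu
    have h1 : P = 1 := hP.eq_one_of_isUnit hu
    have h2 := prodXSubSMul.eval (annihilator Λ (latticeM ρ)) (convSeries ρ Λ) x
    rw [← hPmap, h1, Polynomial.map_one, eval_one] at h2
    exact one_ne_zero h2
  have : P = p := eq_of_monic_of_associated hP hmon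
    ((hirr.dvd_iff.mp hdvd).resolve_left hnu).symm
  rw [← this, hPmap]

theorem dvd_of_aeval_eq_zero (hM : latticeM ρ ≤ Λ) (hi : (latticeM ρ).relIndex Λ ≠ 0)
    {x : convSeries ρ Λ} {p : (BaseRing ρ)[X]} (hmon : p.Monic) (hirr : Irreducible p)
    (hx : aeval (x : Series ρ) p = 0) {Q : (BaseRing ρ)[X]} (hQ : aeval (x : Series ρ) Q = 0) :
    p ∣ Q := by
  rw [← map_dvd_map (baseInclusion hM) (baseInclusion_injective hM) hmon,
    map_eq_prodXSubSMul hM hi hmon hirr hx]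
  exact prodXSubSMul_dvd hM hQ

/-- The factorization persists in the domain of all series, so a root there, with no condition on
its exponents, is already a conjugate of `x`. -/
theorem exists_smul_eq_of_aeval_eq_zero (hM : latticeM ρ ≤ Λ) (hi : (latticeM ρ).relIndex Λ ≠ 0)
    {x : convSeries ρ Λ} {p : (BaseRing ρ)[X]} (hmon : p.Monic) (hirr : Irreducible p)
    (hx : aeval (x : Series ρ) p = 0) {z : Series ρ} (hz : aeval z p = 0) :
    ∃ χ ∈ annihilator Λ (latticeM ρ), z = (χ • x : convSeries ρ Λ) := by
  have h1 : ((p.map (baseInclusion hM)).map (convSeries ρ Λ).val.toRingHom).eval z = 0 := by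
    rw [Polynomial.map_map, eval_map]
    exact hz
  rw [map_eq_prodXSubSMul hM hi hmon hirr hx, prodXSubSMul, Polynomial.map_prod, eval_prod,
    Finset.prod_eq_zero_iff] at h1
  obtain ⟨g, -, hg⟩ := h1
  induction g using QuotientGroup.induction_on with
  | H g =>
    rw [Polynomial.map_sub, map_X, map_C, eval_sub, eval_X, eval_C, sub_eq_zero] at hg
    exact ⟨g.1, g.2, hg⟩

/-- Orbit-stabilizer: the degree is the length of the orbit. -/
theorem natDegree_mul_card_stabilizer (hM : latticeM ρ ≤ Λ) (hi : (latticeM ρ).relIndex Λ ≠ 0)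
    {x : convSeries ρ Λ} {p : (BaseRing ρ)[X]} (hmon : p.Monic) (hirr : Irreducible p)
    (hx : aeval (x : Series ρ) p = 0) :
    p.natDegree * Nat.card (MulAction.stabilizer (annihilator Λ (latticeM ρ)) x) =
      (latticeM ρ).relIndex Λ := by
  rw [← card_annihilator hi,
    Subgroup.card_eq_card_quotient_mul_card_subgroup
      (MulAction.stabilizer (annihilator Λ (latticeM ρ)) x)]
  congr 1
  classical
  rw [← natDegree_map_eq_of_injective (baseInclusion_injective hM),
    map_eq_prodXSubSMul hM hi hmon hirr hx, prodXSubSMul_eq_prod,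
    natDegree_prod_of_monic _ _ fun g _ => monic_X_sub_C _]
  simp only [natDegree_X_sub_C, Finset.sum_const, Finset.card_univ, smul_eq_mul, mul_one,
    Nat.card_eq_fintype_card]

/-- Each conjugate arises from a full coset of the stabilizer. Taking the product over the whole
group allows exponents to be summed over characters instead of over roots. -/
theorem prod_sub_smul_eq_pow (hM : latticeM ρ ≤ Λ) (hi : (latticeM ρ).relIndex Λ ≠ 0)
    {x : convSeries ρ Λ} {p : (BaseRing ρ)[X]} (hmon : p.Monic) (hirr : Irreducible p)
    (hx : aeval (x : Series ρ) p = 0) (y : convSeries ρ Λ) :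
    ∏ χ : annihilator Λ (latticeM ρ), (y - χ • x) = (p.map (baseInclusion hM)).eval y ^
      Nat.card (MulAction.stabilizer (annihilator Λ (latticeM ρ)) x) := by
  classical
  rw [map_eq_prodXSubSMul hM hi hmon hirr hx, prodXSubSMul_eq_prod, eval_prod,
    ← Finset.prod_pow]
  rw [← Finset.prod_fiberwise Finset.univ
    (QuotientGroup.mk (s := MulAction.stabilizer (annihilator Λ (latticeM ρ)) x))]
  refine Finset.prod_congr rfl fun g _ => ?_
  have h1 : ∀ χ ∈ Finset.univ.filter fun χ : annihilator Λ (latticeM ρ) =>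
      (QuotientGroup.mk χ : _ ⧸ MulAction.stabilizer (annihilator Λ (latticeM ρ)) x) = g,
      y - χ • x = eval y (X - C (MulAction.ofQuotientStabilizer _ x g)) := by
    intro χ hχ
    rw [← (Finset.mem_filter.mp hχ).2, MulAction.ofQuotientStabilizer_mk, eval_sub, eval_X, eval_C]
  rw [Finset.prod_congr rfl h1, Finset.prod_const]
  congr 1
  induction g using QuotientGroup.induction_on with
  | H g =>
    rw [← Fintype.card_subtype, ← Nat.card_eq_fintype_card]
    exact Nat.card_congr
      { toFun := fun χ => ⟨g⁻¹ * χ.1, QuotientGroup.eq.mp χ.2.symm⟩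
        invFun := fun s => ⟨g * s.1, (QuotientGroup.eq.mpr (by simp)).symm⟩
        left_inv := fun χ => Subtype.ext (mul_inv_cancel_left g χ.1)
        right_inv := fun s => Subtype.ext (inv_mul_cancel_left g s.1) }

end Orbit

end ToricQO

/-! ### The lattices M_k, the indices n_k and the vectors γ_k -/

namespace ToricQO

variable {d : ℕ} {ρ : RationalCone d} {lam : ℕ → Expo ρ}

theorem charLattice_zero (lam : ℕ → Expo ρ) : charLattice lam 0 = latticeM ρ := by
  simp [charLattice]

theorem charLattice_mono (lam : ℕ → Expo ρ) : Monotone (charLattice lam) := fun _ _ h =>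
  sup_le_sup_left (AddSubgroup.closure_mono (Set.image_mono (Set.Icc_subset_Icc_right h))) _

theorem latticeM_le_charLattice (lam : ℕ → Expo ρ) (k : ℕ) : latticeM ρ ≤ charLattice lam k :=
  le_sup_left

theorem lam_mem_charLattice (lam : ℕ → Expo ρ) {i k : ℕ} (hi : 1 ≤ i) (hik : i ≤ k) :
    lam i ∈ charLattice lam k :=
  AddSubgroup.mem_sup_right (AddSubgroup.subset_closure ⟨i, ⟨hi, hik⟩, rfl⟩)

theorem charLattice_le {Λ : AddSubgroup (Expo ρ)} {k : ℕ} (hM : latticeM ρ ≤ Λ)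
    (h : ∀ i, 1 ≤ i → i ≤ k → lam i ∈ Λ) : charLattice lam k ≤ Λ := by
  refine sup_le hM ((AddSubgroup.closure_le _).mpr ?_)
  rintro _ ⟨i, ⟨h1, h2⟩, rfl⟩
  exact h i h1 h2

theorem charLattice_succ (lam : ℕ → Expo ρ) (k : ℕ) :
    charLattice lam (k + 1) = charLattice lam k ⊔ AddSubgroup.zmultiples (lam (k + 1)) := by
  refine le_antisymm (charLattice_le ((latticeM_le_charLattice lam k).trans le_sup_left) ?_)
    (sup_le (charLattice_mono lam k.le_succ) ?_)
  · intro i h1 h2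
    rcases Nat.le_succ_iff.mp h2 with h | rfl
    · exact AddSubgroup.mem_sup_left (lam_mem_charLattice lam h1 h)
    · exact AddSubgroup.mem_sup_right (AddSubgroup.mem_zmultiples _)
  · rw [AddSubgroup.zmultiples_le]
    exact lam_mem_charLattice lam (Nat.le_add_left 1 k) le_rfl

theorem charInt_succ (lam : ℕ → Expo ρ) (k : ℕ) :
    charInt lam (k + 1) = (charLattice lam k).relIndex (charLattice lam (k + 1)) := rfl

theorem prod_charInt (lam : ℕ → Expo ρ) (j : ℕ) :
    ∏ k ∈ Finset.range (j + 1), charInt lam k = (latticeM ρ).relIndex (charLattice lam j) := by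
  induction j with
  -- Truncated subtraction gives `0 - 1 = 0`, hence n_0 = [M : M] = 1.
  | zero => simp [charInt, charLattice_zero]
  | succ j ih =>
    rw [Finset.prod_range_succ, ih, charInt_succ]
    exact AddSubgroup.relIndex_mul_relIndex _ _ _ (latticeM_le_charLattice lam j)
      (charLattice_mono lam j.le_succ)

/-- `M_{k+1} / M_k` is cyclic of order `n_{k+1}`, generated by `λ_{k+1}`. -/
theorem charInt_dvd_of_zsmul_mem {k : ℕ} {z : ℤ} (h : z • lam (k + 1) ∈ charLattice lam k) :
    (charInt lam (k + 1) : ℤ) ∣ z := by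
  let l : charLattice lam (k + 1) := ⟨lam (k + 1), lam_mem_charLattice lam (by omega) le_rfl⟩
  let K := (charLattice lam k).addSubgroupOf (charLattice lam (k + 1))
  have hgen : ∀ a : charLattice lam (k + 1) ⧸ K,
      a ∈ AddSubgroup.zmultiples (QuotientAddGroup.mk l : charLattice lam (k + 1) ⧸ K) := by
    intro a
    induction a using QuotientAddGroup.induction_on with
    | H a =>
      obtain ⟨b, hb, _, ⟨t, rfl⟩, hbt⟩ :=
        AddSubgroup.mem_sup.mp ((charLattice_succ lam k).le a.2)
      refine ⟨t, ?_⟩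
      change t • (QuotientAddGroup.mk l : charLattice lam (k + 1) ⧸ K) = _
      rw [← QuotientAddGroup.mk_zsmul, QuotientAddGroup.eq]
      change -(t • lam (k + 1)) + (a : Expo ρ) ∈ charLattice lam k
      rw [← hbt]
      simpa using hb
  have hord := addOrderOf_eq_card_of_forall_mem_zmultiples hgen
  have hcard : Nat.card (charLattice lam (k + 1) ⧸ K) = charInt lam (k + 1) := rfl
  rw [← hcard, ← hord, addOrderOf_dvd_iff_zsmul_eq_zero, ← QuotientAddGroup.mk_zsmul,
    QuotientAddGroup.eq_zero_iff]
  exact h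

theorem charInt_nsmul_mem {k : ℕ} {u : Expo ρ} (h : u ∈ charLattice lam (k + 1)) :
    charInt lam (k + 1) • u ∈ charLattice lam k :=
  AddSubgroup.mem_addSubgroupOf.mp (AddSubgroup.nsmul_index_mem
    ((charLattice lam k).addSubgroupOf (charLattice lam (k + 1))) ⟨u, h⟩)

theorem gam_succ_succ (lam : ℕ → Expo ρ) (j : ℕ) :
    gam lam (j + 2) = charInt lam (j + 1) • gam lam (j + 1) + lam (j + 2) - lam (j + 1) := rfl

theorem gam_mem_charLattice (lam : ℕ → Expo ρ) (k : ℕ) :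
    gam lam (k + 1) ∈ charLattice lam (k + 1) := by
  induction k with
  | zero => exact lam_mem_charLattice lam le_rfl le_rfl
  | succ k ih =>
    rw [gam_succ_succ]
    refine sub_mem (add_mem (nsmul_mem (charLattice_mono lam (by omega) ih) _)
      (lam_mem_charLattice lam (by omega) le_rfl)) (lam_mem_charLattice lam (by omega) (by omega))

/-- By the recursion, the difference is n_kγ_k - λ_k, which involves only M_k. Thus γ_{k+1} also
generates M_{k+1} modulo M_k. -/
theorem gam_sub_lam_mem (lam : ℕ → Expo ρ) (k : ℕ) :
    gam lam (k + 1) - lam (k + 1) ∈ charLattice lam k := by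
  cases k with
  | zero => simp [gam]
  | succ k =>
    have h : gam lam (k + 2) - lam (k + 2) =
        charInt lam (k + 1) • gam lam (k + 1) - lam (k + 1) := by
      rw [gam_succ_succ]
      abel
    rw [h]
    exact sub_mem (nsmul_mem (gam_mem_charLattice lam k) _)
      (lam_mem_charLattice lam (by omega) le_rfl)

theorem charInt_dvd_of_zsmul_gam_mem {k : ℕ} {z : ℤ}
    (h : z • gam lam (k + 1) ∈ charLattice lam k) : (charInt lam (k + 1) : ℤ) ∣ z := by
  refine charInt_dvd_of_zsmul_mem ?_
  have := sub_mem h (zsmul_mem (gam_sub_lam_mem lam k) z)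
  rwa [← zsmul_sub, sub_sub_cancel] at this

/-- The elements `γ_1, …, γ_k` are independent modulo `M` for coefficients of absolute value less
than `n_1, …, n_k`. -/
theorem eq_zero_of_sum_zsmul_gam_mem (k : ℕ) (z : ℕ → ℤ) (hz : ∀ i < k, |z i| < charInt lam (i + 1))
    (h : ∑ i ∈ Finset.range k, z i • gam lam (i + 1) ∈ latticeM ρ) : ∀ i < k, z i = 0 := by
  induction k with
  | zero => exact fun i hi => absurd hi (Nat.not_lt_zero i)
  | succ k ih =>
    have hS : ∑ i ∈ Finset.range k, z i • gam lam (i + 1) ∈ charLattice lam k :=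
      sum_mem fun i hi => zsmul_mem
        (charLattice_mono lam (Finset.mem_range.mp hi) (gam_mem_charLattice lam i)) _
    rw [Finset.sum_range_succ] at h
    have hk : z k • gam lam (k + 1) ∈ charLattice lam k := by
      have := sub_mem (latticeM_le_charLattice lam k h) hS
      rwa [add_sub_cancel_left] at this
    -- The top coefficient is divisible by n_{k+1} and smaller than it in absolute value; the lower
    -- ones follow by induction.
    have hzk : z k = 0 :=
      Int.eq_zero_of_abs_lt_dvd (charInt_dvd_of_zsmul_gam_mem hk) (hz k k.lt_succ_self)
    rw [hzk, zero_smul, add_zero] at h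
    intro i hi
    rcases Nat.lt_succ_iff_lt_or_eq.mp hi with hi | rfl
    · exact ih (fun i hi => hz i (by omega)) h i hi
    · exact hzk

/-- Reduced monomials are determined by their weight. -/
theorem eq_of_weight_eq {g : ℕ} {v v' : Fin g →₀ ℕ} {α α' : Expo ρ} (hα : α ∈ latticeM ρ)
    (hα' : α' ∈ latticeM ρ) (hv : ∀ i, v i < charInt lam (i + 1))
    (hv' : ∀ i, v' i < charInt lam (i + 1)) (h : weight lam α v = weight lam α' v') :
    v = v' ∧ α = α' := by
  let z : ℕ → ℤ := fun i => if hi : i < g then (v ⟨i, hi⟩ : ℤ) - v' ⟨i, hi⟩ else 0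
  have hsum : ∑ i ∈ Finset.range g, z i • gam lam (i + 1) = α' - α := by
    rw [Finset.sum_range, eq_sub_iff_add_eq', ← sub_eq_zero]
    unfold weight at h
    rw [← sub_eq_zero] at h
    rw [← h]
    have : ∀ i : Fin g, z i • gam lam (i + 1) = v i • gam lam (i + 1) - v' i • gam lam (i + 1) := by
      intro i
      simp only [z, i.2, dif_pos, Fin.eta, sub_smul, natCast_zsmul]
    rw [Finset.sum_congr rfl fun i _ => this i, Finset.sum_sub_distrib]
    abel
  have hz : ∀ i < g, z i = 0 := by
    refine eq_zero_of_sum_zsmul_gam_mem g z (fun i hi => ?_) (hsum ▸ sub_mem hα' hα)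
    have h1 := hv ⟨i, hi⟩
    have h2 := hv' ⟨i, hi⟩
    simp only at h1 h2
    simp only [z, dif_pos hi, abs_lt]
    omega
  have hvv : v = v' := by
    ext i
    have := hz i i.2
    simp only [z, i.2, dif_pos, Fin.eta] at this
    omega
  refine ⟨hvv, ?_⟩
  rw [hvv] at h
  exact add_right_cancel h

end ToricQO

/-! ### Discriminants and differences of roots -/

namespace ToricQO

/-- The difference of two different roots of a monic polynomial divides the discriminant. -/
theorem sub_dvd_map_discr {R S : Type*} [CommRing R] [CommRing S] [IsDomain S] (φ : R →+* S)
    {p : R[X]} (hmon : p.Monic) {a b : S} (ha : (p.map φ).eval a = 0)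
    (hb : (p.map φ).eval b = 0) (hab : a ≠ b) : a - b ∣ φ p.discr := by
  have : Nontrivial R := φ.domain_nontrivial
  have hdeg : 0 < p.degree := by
    by_contra h
    rw [not_lt, hmon.degree_le_zero_iff_eq_one] at h
    rw [h, Polynomial.map_one, eval_one] at ha
    exact one_ne_zero ha
  -- The discriminant is, up to sign, a combination of `p` and `p'`. At `a` only the multiple of
  -- p'(a) survives, and p'(a) is divisible by a - b because p = (X - a)(X - b)Q'.
  obtain ⟨s, t, -, -, hst⟩ := exists_mul_add_mul_eq_C_resultant p p.derivative le_rfl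
    (natDegree_derivative_le p) (Or.inl (natDegree_pos_iff_degree_pos.mpr hdeg).ne')
  rw [resultant_deriv hdeg, hmon.leadingCoeff, mul_one] at hst
  have h1 := congrArg (fun r => (r.map φ).eval a) hst
  simp only [Polynomial.map_add, Polynomial.map_mul, eval_add, eval_mul, ha, zero_mul, zero_add,
    Polynomial.map_C, eval_C] at h1
  rw [map_mul, map_pow, map_neg, map_one] at h1
  obtain ⟨Q, hQ⟩ := dvd_iff_isRoot.mpr ha
  have hQb : Q.eval b = 0 := by
    rw [hQ, eval_mul, eval_sub, eval_X, eval_C] at hb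
    exact (mul_eq_zero.mp hb).resolve_left (sub_ne_zero.mpr hab.symm)
  obtain ⟨Q', rfl⟩ := dvd_iff_isRoot.mpr hQb
  have hder : ((p.derivative).map φ).eval a = (a - b) * Q'.eval a := by
    rw [← derivative_map, hQ]
    simp [derivative_mul]
  rw [hder] at h1
  have hu : IsUnit ((-1 : S) ^ (p.natDegree * (p.natDegree - 1) / 2)) := (isUnit_one.neg).pow _
  rw [← hu.dvd_mul_left, ← h1, mul_assoc]
  exact dvd_mul_right _ _

variable {d : ℕ} {ρ : RationalCone d}

instance : IsAddTorsionFree (Expo ρ) := inferInstanceAs (IsAddTorsionFree (Fin d → ℝ))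

theorem isLeast_support_discr {p : (BaseRing ρ)[X]} (h : IsQuasiOrdinary p) :
    ∃ η, IsLeast (p.discr : Series ρ).support η := by
  obtain ⟨η, H, h0, hp⟩ := h
  refine ⟨η, isLeast_of_isMonomialTimesUnit ⟨H, ⟨1, one_pos, H.2⟩, h0, ?_⟩⟩
  rw [hp]
  rfl

/-- The difference divides the discriminant, which is a monomial times a unit, and this property
passes to factors. -/
theorem exists_isLeast_sub {Λ : AddSubgroup (Expo ρ)} (hM : latticeM ρ ≤ Λ) {p : (BaseRing ρ)[X]}
    (hqo : IsQuasiOrdinary p) (hmon : p.Monic) {a b : convSeries ρ Λ}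
    (ha : aeval (a : Series ρ) p = 0) (hb : aeval (b : Series ρ) p = 0) (hab : a ≠ b) :
    ∃ u, IsLeast ((a - b : convSeries ρ Λ) : Series ρ).support u := by
  obtain ⟨η, hη⟩ := isLeast_support_discr hqo
  obtain ⟨c, hc⟩ := sub_dvd_map_discr (baseInclusion hM) hmon
    ((eval_map_eq_zero_iff hM p a).mpr ha) ((eval_map_eq_zero_iff hM p b).mpr hb) hab
  rw [← coe_baseInclusion hM, hc] at hη
  exact exists_isLeast_of_mul hη

theorem coeff_sub_smul_ne_zero_iff {Λ : AddSubgroup (Expo ρ)} (χ : AddChar Λ Circle)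
    (x : convSeries ρ Λ) (u : Λ) : ((x - χ • x : convSeries ρ Λ) : Series ρ).coeff u ≠ 0 ↔
      (x : Series ρ).coeff u ≠ 0 ∧ χ u ≠ 1 := by
  have h : ((x - χ • x : convSeries ρ Λ) : Series ρ).coeff u =
      (1 - (χ u : ℂ)) * (x : Series ρ).coeff u := by
    change (x : Series ρ).coeff u - ((χ • x : convSeries ρ Λ) : Series ρ).coeff u = _
    rw [coeff_smul_of_mem χ x u.2]
    ring
  rw [h, mul_ne_zero_iff, sub_ne_zero, and_comm]
  refine and_congr_right fun _ => not_congr ?_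
  rw [eq_comm]
  exact Circle.coe_eq_one

theorem mem_annihilator_charLattice {Λ : AddSubgroup (Expo ρ)} {lam : ℕ → Expo ρ} {k : ℕ}
    (hlam : ∀ i, 1 ≤ i → i ≤ k → lam i ∈ Λ) (hM : latticeM ρ ≤ Λ) {χ : AddChar Λ Circle}
    (hχ : χ ∈ annihilator Λ (latticeM ρ))
    (h : ∀ i (h1 : 1 ≤ i) (h2 : i ≤ k), χ ⟨lam i, hlam i h1 h2⟩ = 1) :
    χ ∈ annihilator Λ (charLattice lam k) := by
  have hle : charLattice lam k ≤ χ.toAddMonoidHom.ker.map Λ.subtype := by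
    refine charLattice_le (fun u hu => ⟨⟨u, hM hu⟩, hχ ⟨u, hM hu⟩ hu, rfl⟩) fun i h1 h2 => ?_
    exact ⟨⟨lam i, hlam i h1 h2⟩, h i h1 h2, rfl⟩
  intro u hu
  obtain ⟨v, hv, hvu⟩ := hle hu
  rw [Subtype.ext hvu.symm]
  exact hv

/-! ### Contact of conjugates and the values of the semi-roots -/

namespace IsBranch

variable {f : (BaseRing ρ)[X]} {ζ : Series ρ} {g : ℕ} {lam : ℕ → Expo ρ}

theorem natDegree_pos (hf : IsBranch f ζ g lam) : 0 < f.natDegree := by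
  refine Nat.pos_of_ne_zero fun h => ?_
  exact hf.irreducible.not_isUnit (by rw [hf.monic.natDegree_eq_zero.mp h]; exact isUnit_one)

theorem aeval_smul_eq_zero (hf : IsBranch f ζ g lam) {m : ℕ}
    {x : convSeries ρ (fracLattice ρ m)} (hx : (x : Series ρ) = ζ)
    {χ : AddChar (fracLattice ρ m) Circle}
    (hχ : χ ∈ annihilator (fracLattice ρ m) (latticeM ρ)) :
    aeval ((χ • x : convSeries ρ (fracLattice ρ m)) : Series ρ) f = 0 := by
  have h := hf.root
  rw [← hx, ← eval_map_eq_zero_iff latticeM_le] at h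
  rw [← eval_map_eq_zero_iff latticeM_le, eval_map_smul latticeM_le hχ, h, smul_zero]

theorem exists_isLeast_sub_smul (hf : IsBranch f ζ g lam) {m : ℕ} (hm : 0 < m)
    {x : convSeries ρ (fracLattice ρ m)} (hx : (x : Series ρ) = ζ)
    {χ : AddChar (fracLattice ρ m) Circle}
    (hχ : χ ∈ annihilator (fracLattice ρ m) (latticeM ρ)) (hne : χ • x ≠ x) :
    ∃ i ∈ Set.Icc 1 g,
      IsLeast ((x - χ • x : convSeries ρ (fracLattice ρ m)) : Series ρ).support (lam i) := by
  have hr := hf.root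
  rw [← hx] at hr
  have hr' := hf.aeval_smul_eq_zero hx hχ
  obtain ⟨u, hu⟩ := exists_isLeast_sub latticeM_le hf.quasiOrdinary hf.monic hr hr' hne.symm
  have hmem : u ∈ charExponents f :=
    ⟨x, ⟨⟨m, hm, x.2⟩, hr⟩, (χ • x : convSeries ρ (fracLattice ρ m)), ⟨⟨m, hm, (χ • x).2⟩, hr'⟩,
      fun h => hne (Subtype.ext h.symm), isMonomialTimesUnit_of_isLeast hm (x - χ • x).2 hu⟩
  rw [← hf.charExponents_eq] at hmem
  obtain ⟨i, hi, rfl⟩ := hmem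
  exact ⟨i, hi, hu⟩

/-- A characteristic exponent comes from two roots χζ and ψζ. Applying χ⁻¹, which preserves
supports, makes the first of them ζ. -/
theorem exists_character_isLeast (hf : IsBranch f ζ g lam) {m : ℕ} (hm : 0 < m)
    {x : convSeries ρ (fracLattice ρ m)} (hx : (x : Series ρ) = ζ)
    {i : ℕ} (hi : i ∈ Set.Icc 1 g) :
    ∃ χ ∈ annihilator (fracLattice ρ m) (latticeM ρ),
      IsLeast ((x - χ • x : convSeries ρ (fracLattice ρ m)) : Series ρ).support (lam i) := by
  have hmem : lam i ∈ charExponents f := hf.charExponents_eq ▸ Set.mem_image_of_mem lam hi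
  obtain ⟨z, hz, z', hz', -, hzz⟩ := hmem
  have hind := relIndex_latticeM_ne_zero (ρ := ρ) hm
  have := finite_annihilator hind
  have := Fintype.ofFinite (annihilator (fracLattice ρ m) (latticeM ρ))
  have hr := hf.root
  rw [← hx] at hr
  obtain ⟨χ, hχ, rfl⟩ := exists_smul_eq_of_aeval_eq_zero latticeM_le hind hf.monic hf.irreducible
    hr hz.2
  obtain ⟨ψ, hψ, rfl⟩ := exists_smul_eq_of_aeval_eq_zero latticeM_le hind hf.monic hf.irreducible
    hr hz'.2
  refine ⟨χ⁻¹ * ψ, mul_mem (inv_mem hχ) hψ, ?_⟩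
  have h1 : χ • (x - (χ⁻¹ * ψ) • x) = χ • x - ψ • x := by
    rw [smul_sub, smul_smul, mul_inv_cancel_left]
  rw [← support_smul_eq χ, h1]
  exact isLeast_of_isMonomialTimesUnit hzz

theorem coeff_lam_ne_zero (hf : IsBranch f ζ g lam) {m : ℕ} (hm : 0 < m)
    {x : convSeries ρ (fracLattice ρ m)} (hx : (x : Series ρ) = ζ)
    {i : ℕ} (hi : i ∈ Set.Icc 1 g) : (x : Series ρ).coeff (lam i) ≠ 0 := by
  obtain ⟨χ, hχ, h⟩ := hf.exists_character_isLeast hm hx hi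
  have hmem := ((x - χ • x).2.1 _ h.1).2
  exact ((coeff_sub_smul_ne_zero_iff χ x ⟨lam i, hmem⟩).mp h.1).1

theorem lam_mem_fracLattice (hf : IsBranch f ζ g lam) {m : ℕ} (hm : 0 < m)
    {x : convSeries ρ (fracLattice ρ m)} (hx : (x : Series ρ) = ζ)
    {i : ℕ} (hi : i ∈ Set.Icc 1 g) : lam i ∈ fracLattice ρ m :=
  (x.2.1 _ (hf.coeff_lam_ne_zero hm hx hi)).2

theorem charLattice_le_fracLattice (hf : IsBranch f ζ g lam) {m : ℕ} (hm : 0 < m)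
    {x : convSeries ρ (fracLattice ρ m)} (hx : (x : Series ρ) = ζ)
    {k : ℕ} (hk : k ≤ g) : charLattice lam k ≤ fracLattice ρ m :=
  charLattice_le latticeM_le fun _ h1 h2 => hf.lam_mem_fracLattice hm hx ⟨h1, h2.trans hk⟩

/-- If `χ` is trivial on `M_k` but not on `M_{k+1}`, then `ζ - χ ζ = X^{λ_{k+1}} · unit`. -/
theorem isLeast_sub_smul (hf : IsBranch f ζ g lam) {m : ℕ} (hm : 0 < m)
    {x : convSeries ρ (fracLattice ρ m)} (hx : (x : Series ρ) = ζ)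
    {χ : AddChar (fracLattice ρ m) Circle} {k : ℕ} (hk : k + 1 ≤ g)
    (h0 : χ ∈ annihilator (fracLattice ρ m) (charLattice lam k))
    (h1 : χ ∉ annihilator (fracLattice ρ m) (charLattice lam (k + 1))) :
    IsLeast ((x - χ • x : convSeries ρ (fracLattice ρ m)) : Series ρ).support (lam (k + 1)) := by
  have hχ : χ ∈ annihilator (fracLattice ρ m) (latticeM ρ) :=
    fun u hu => h0 u (latticeM_le_charLattice lam k hu)
  have hk1 : k + 1 ∈ Set.Icc 1 g := ⟨by omega, hk⟩
  have hmem := hf.lam_mem_fracLattice hm hx hk1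
  have hne : χ ⟨lam (k + 1), hmem⟩ ≠ 1 := by
    intro h
    refine h1 (mem_annihilator_charLattice
      (fun i h1 h2 => hf.lam_mem_fracLattice hm hx ⟨h1, h2.trans hk⟩) latticeM_le hχ
      fun i hi1 hi2 => ?_)
    rcases Nat.le_succ_iff.mp hi2 with hi | rfl
    · exact h0 _ (lam_mem_charLattice lam hi1 hi)
    · exact h
  have hcoeff := (coeff_sub_smul_ne_zero_iff χ x ⟨lam (k + 1), hmem⟩).mpr
    ⟨hf.coeff_lam_ne_zero hm hx hk1, hne⟩
  obtain ⟨i, hi, hL⟩ := hf.exists_isLeast_sub_smul hm hx hχ fun h => by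
    rw [h, sub_self] at hcoeff
    exact hcoeff rfl
  -- Exponents in M_k disappear from ζ - χζ, so i > k; conversely λ_{k+1} occurs in it, so i ≤ k +
  -- 1.
  have hik : k + 1 ≤ i := by
    by_contra hlt
    have hmem' := hf.lam_mem_fracLattice hm hx hi
    exact ((coeff_sub_smul_ne_zero_iff χ x ⟨lam i, hmem'⟩).mp hL.1).2
      (h0 _ (lam_mem_charLattice lam hi.1 (by omega)))
  have hki : i ≤ k + 1 := (hf.strictMono.le_iff_le hi hk1).mp (hL.2 hcoeff)
  rwa [le_antisymm hki hik] at hL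

/-- The exponent of `ζ - χ ξ` for a series `ξ` whose order of coincidence with `ζ` is
`λ_{j+1}`. -/
noncomputable def contactExponent {Λ : AddSubgroup (Expo ρ)} (lam : ℕ → Expo ρ) (j : ℕ)
    (χ : AddChar Λ Circle) : Expo ρ :=
  open scoped Classical in
  lam 1 + ∑ i ∈ Finset.range j,
    if χ ∈ annihilator Λ (charLattice lam (i + 1)) then lam (i + 2) - lam (i + 1) else 0

/-- Only the increments with i < k survive, and they telescope to λ_{k+1} - λ_1. Written with
increments, the sum over all χ reduces to counting the characters trivial on each M_i. -/
theorem contactExponent_eq {Λ : AddSubgroup (Expo ρ)} {j k : ℕ} (hk : k ≤ j)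
    {χ : AddChar Λ Circle} (h : ∀ i ≤ j, χ ∈ annihilator Λ (charLattice lam i) ↔ i ≤ k) :
    contactExponent lam j χ = lam (k + 1) := by
  classical
  unfold contactExponent
  have h1 : ∀ i ∈ Finset.range j,
      (if χ ∈ annihilator Λ (charLattice lam (i + 1)) then lam (i + 2) - lam (i + 1) else 0) =
        if i ∈ Finset.range k then lam (i + 2) - lam (i + 1) else 0 := by
    intro i hi
    have := h (i + 1) (Finset.mem_range.mp hi)
    exact if_congr (this.trans (Nat.succ_le_iff.trans Finset.mem_range.symm)) rfl rfl
  rw [Finset.sum_congr rfl h1, Finset.sum_ite_mem,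
    Finset.inter_eq_right.mpr (Finset.range_mono hk), Finset.sum_range_sub fun i => lam (i + 1)]
  abel

/-- If χ is trivial on M_j, then χy = y and the contact is λ_{j+1}. Otherwise ζ - χy = (ζ - χζ) +
χ(ζ - y), where the first summand has the smaller exponent λ_{k+1} and dominates. -/
theorem isLeast_sub_smul_of_coincidence (hf : IsBranch f ζ g lam) {m : ℕ} (hm : 0 < m)
    {x y : convSeries ρ (fracLattice ρ m)} (hx : (x : Series ρ) = ζ) {j : ℕ} (hj : j + 1 ≤ g)
    (hy : IsLeast ((x - y : convSeries ρ (fracLattice ρ m)) : Series ρ).support (lam (j + 1)))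
    {χ : AddChar (fracLattice ρ m) Circle}
    (hχ : χ ∈ annihilator (fracLattice ρ m) (latticeM ρ))
    (hstab : χ ∈ annihilator (fracLattice ρ m) (charLattice lam j) → χ • y = y) :
    IsLeast ((x - χ • y : convSeries ρ (fracLattice ρ m)) : Series ρ).support
      (contactExponent lam j χ) := by
  have hanti : ∀ {i k : ℕ}, i ≤ k → χ ∈ annihilator (fracLattice ρ m) (charLattice lam k) →
      χ ∈ annihilator (fracLattice ρ m) (charLattice lam i) :=
    fun hik h u hu => h u (charLattice_mono lam hik hu)
  by_cases hj' : χ ∈ annihilator (fracLattice ρ m) (charLattice lam j)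
  · rw [hstab hj', contactExponent_eq le_rfl fun i hi => iff_of_true (hanti hi hj') hi]
    exact hy
  · classical
    have hex : ∃ i, χ ∉ annihilator (fracLattice ρ m) (charLattice lam i) := ⟨j, hj'⟩
    -- The first lattice on which χ is nontrivial is not M_0 = M, so its index is a successor.
    obtain ⟨k, hk⟩ : ∃ k, Nat.find hex = k + 1 := Nat.exists_eq_succ_of_ne_zero fun h0 => by
      have := Nat.find_spec hex
      rw [h0, charLattice_zero] at this
      exact this hχ
    have hkj : k + 1 ≤ j := hk ▸ Nat.find_min' hex hj'
    have h0 : χ ∈ annihilator (fracLattice ρ m) (charLattice lam k) :=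
      not_not.mp (Nat.find_min hex (by omega))
    have h1 : χ ∉ annihilator (fracLattice ρ m) (charLattice lam (k + 1)) :=
      hk ▸ Nat.find_spec hex
    have h2 := hf.isLeast_sub_smul hm hx (by omega) h0 h1
    rw [contactExponent_eq (k := k) (by omega) fun i _ =>
      ⟨fun h => by by_contra hlt; exact h1 (hanti (by omega) h), fun h => hanti h h0⟩]
    have h3 : x - χ • y = (x - χ • x) + χ • (x - y) := by
      rw [smul_sub]
      abel
    rw [h3]
    refine isLeast_add_of_lt h2 ?_ (hf.strictMono ⟨by omega, by omega⟩ ⟨by omega, hj⟩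
      (show k + 1 < j + 1 by omega))
    rw [support_smul_eq]
    exact hy

/-- There are [Λ : M_i] characters trivial on M_i. Since [Λ : M_j] = n_{j+1}[Λ : M_{j+1}], the
resulting sum obeys the recursion that defines γ. -/
theorem sum_contactExponent {Λ : AddSubgroup (Expo ρ)} (hi : (latticeM ρ).relIndex Λ ≠ 0)
    [Fintype (annihilator Λ (latticeM ρ))] {j : ℕ} (hle : charLattice lam j ≤ Λ) :
    ∑ χ : annihilator Λ (latticeM ρ), contactExponent lam j (χ : AddChar Λ Circle) =
      (charLattice lam j).relIndex Λ • gam lam (j + 1) := by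
  classical
  have hrel : ∀ i ≤ j, (charLattice lam i).relIndex Λ ≠ 0 := fun i hij => right_ne_zero_of_mul
    (by rwa [AddSubgroup.relIndex_mul_relIndex _ _ _ (latticeM_le_charLattice lam i)
      ((charLattice_mono lam hij).trans hle)])
  have hcount : ∀ i ≤ j, (Finset.univ.filter fun χ : annihilator Λ (latticeM ρ) =>
      (χ : AddChar Λ Circle) ∈ annihilator Λ (charLattice lam i)).card =
        (charLattice lam i).relIndex Λ := by
    intro i hij
    rw [← card_annihilator (hrel i hij), ← Fintype.card_subtype, ← Nat.card_eq_fintype_card]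
    exact Nat.card_congr
      { toFun := fun χ => ⟨χ.1.1, χ.2⟩
        invFun := fun χ => ⟨⟨χ.1, fun u hu => χ.2 u (latticeM_le_charLattice lam i hu)⟩, χ.2⟩
        left_inv := fun _ => rfl
        right_inv := fun _ => rfl }
  have hsum : ∑ χ : annihilator Λ (latticeM ρ), contactExponent lam j (χ : AddChar Λ Circle) =
      (latticeM ρ).relIndex Λ • lam 1 + ∑ i ∈ Finset.range j,
        (charLattice lam (i + 1)).relIndex Λ • (lam (i + 2) - lam (i + 1)) := by
    unfold contactExponent
    rw [Finset.sum_add_distrib, Finset.sum_const, Finset.sum_comm, Finset.card_univ,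
      ← Nat.card_eq_fintype_card, card_annihilator hi]
    congr 1
    refine Finset.sum_congr rfl fun i hi => ?_
    rw [← Finset.sum_filter, Finset.sum_const, hcount (i + 1) (Finset.mem_range.mp hi)]
  rw [hsum]
  clear hsum hcount hrel
  induction j with
  | zero => simp [charLattice_zero, gam]
  | succ j ih =>
    have hle' := (charLattice_mono lam j.le_succ).trans hle
    rw [Finset.sum_range_succ, ← add_assoc, ih hle', gam_succ_succ,
      ← AddSubgroup.relIndex_mul_relIndex _ _ _ (charLattice_mono lam j.le_succ) hle,
      add_sub_assoc, smul_add, smul_smul, charInt_succ, mul_comm]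

/-- The values of the semi-roots at `ζ`: `q_j(ζ) = X^{γ_{j+1}} · unit`. -/
theorem isLeast_aeval_semiRoot (hf : IsBranch f ζ g lam) {j : ℕ} (hj : j + 1 ≤ g)
    {p : (BaseRing ρ)[X]} (hp : IsSemiRoot f g lam j p) :
    IsLeast (aeval ζ p : Series ρ).support (gam lam (j + 1)) := by
  have hco := hp.coincidence
  rw [if_pos hj] at hco
  obtain ⟨z, ⟨⟨m', hm', hzm'⟩, hz⟩, z', ⟨-, hz'⟩, hzz⟩ := hco.2.1
  -- A common denominator for ζ and for the given root of `p`.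
  let m := f.natDegree * m'
  have hm : 0 < m := Nat.mul_pos hf.natDegree_pos hm'
  let x : convSeries ρ (fracLattice ρ m) :=
    ⟨ζ, convSeries_mono (fracLattice_le_of_dvd (dvd_mul_right _ _)) hf.mem⟩
  let y' : convSeries ρ (fracLattice ρ m) :=
    ⟨z, convSeries_mono (fracLattice_le_of_dvd (dvd_mul_left _ _)) hzm'⟩
  have hind := relIndex_latticeM_ne_zero (ρ := ρ) hm
  have := finite_annihilator hind
  have := Fintype.ofFinite (annihilator (fracLattice ρ m) (latticeM ρ))
  obtain ⟨σ, hσ, rfl⟩ := exists_smul_eq_of_aeval_eq_zero latticeM_le hind hf.monic hf.irreducible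
    (x := x) hf.root hz'
  -- The coincidence involves some conjugate σζ; translating by σ⁻¹ gives a root of `p` with the
  -- same contact with ζ itself.
  let y := σ⁻¹ • y'
  have hroot : aeval (y : Series ρ) p = 0 := by
    rw [← eval_map_eq_zero_iff latticeM_le, eval_map_smul latticeM_le (inv_mem hσ),
      (eval_map_eq_zero_iff latticeM_le p y').mpr hz, smul_zero]
  have hxy : IsLeast ((x - y : convSeries ρ (fracLattice ρ m)) : Series ρ).support
      (lam (j + 1)) := by
    have h1 : σ • (x - y) = -(y' - σ • x) := by
      rw [smul_sub, smul_inv_smul, neg_sub]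
    rw [← support_smul_eq σ, h1]
    change IsLeast (-(z - _) : Series ρ).support _
    rw [HahnSeries.support_neg]
    exact isLeast_of_isMonomialTimesUnit hzz
  have hle := hf.charLattice_le_fracLattice hm (x := x) rfl (k := j) (by omega)
  have hrelj : (charLattice lam j).relIndex (fracLattice ρ m) ≠ 0 := right_ne_zero_of_mul
    (by rwa [AddSubgroup.relIndex_mul_relIndex _ _ _ (latticeM_le_charLattice lam j) hle])
  -- the stabilizer of `y` is the annihilator of `M_j`
  have hsub : ∀ χ ∈ MulAction.stabilizer (annihilator (fracLattice ρ m) (latticeM ρ)) y,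
      (χ : AddChar (fracLattice ρ m) Circle) ∈
        annihilator (fracLattice ρ m) (charLattice lam j) := by
    intro χ hχ
    refine mem_annihilator_charLattice (fun i h1 h2 => hle (lam_mem_charLattice lam h1 h2))
      latticeM_le χ.2 fun i h1 h2 => (smul_eq_self_iff χ.1 y).mp hχ _ ?_
    -- Below λ_{j+1} the series ζ and y agree at λ_1, …, λ_j, so these exponents occur in y and a
    -- character fixing y must be trivial on them.
    have hxi := hf.coeff_lam_ne_zero hm (x := x) rfl (i := i) ⟨h1, by omega⟩
    have hxyi : ((x - y : convSeries ρ (fracLattice ρ m)) : Series ρ).coeff (lam i) = 0 := by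
      by_contra hne
      exact (hxy.2 hne).not_gt (hf.strictMono ⟨h1, by omega⟩ ⟨by omega, hj⟩ (by omega))
    have hxyi' : (x : Series ρ).coeff (lam i) - (y : Series ρ).coeff (lam i) = 0 := hxyi
    rwa [← sub_eq_zero.mp hxyi']
  have hdeg := natDegree_mul_card_stabilizer latticeM_le hind hp.monic hp.irreducible hroot
  -- The degree of `p` is [M_j : M]. This makes the stabilizer as large as the annihilator of M_j,
  -- turning the inclusion into an equality.
  have hcard : Nat.card (MulAction.stabilizer (annihilator (fracLattice ρ m) (latticeM ρ)) y) =
      (charLattice lam j).relIndex (fracLattice ρ m) := by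
    rw [hp.natDegree_eq, prod_charInt,
      ← AddSubgroup.relIndex_mul_relIndex _ _ _ (latticeM_le_charLattice lam j) hle] at hdeg
    refine mul_left_cancel₀ (left_ne_zero_of_mul (b := (charLattice lam j).relIndex
      (fracLattice ρ m)) ?_) hdeg
    rwa [AddSubgroup.relIndex_mul_relIndex _ _ _ (latticeM_le_charLattice lam j) hle]
  have hstab : ∀ χ : annihilator (fracLattice ρ m) (latticeM ρ),
      (χ : AddChar (fracLattice ρ m) Circle) ∈
        annihilator (fracLattice ρ m) (charLattice lam j) → χ.1 • y = y := by
    have := finite_annihilator hrelj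
    let F : MulAction.stabilizer (annihilator (fracLattice ρ m) (latticeM ρ)) y →
        annihilator (fracLattice ρ m) (charLattice lam j) := fun χ => ⟨χ.1.1, hsub χ.1 χ.2⟩
    have hF : Function.Injective F := fun a b h =>
      Subtype.ext (Subtype.ext (Subtype.mk.inj h))
    have hbij := hF.bijective_of_nat_card_le (by rw [hcard, card_annihilator hrelj])
    intro χ hχ
    obtain ⟨s, hs⟩ := hbij.2 ⟨χ.1, hχ⟩
    have h1 : s.1.1 = χ.1 := Subtype.mk.inj hs
    rw [← h1]
    exact s.2
  have hprod := congrArg (convSeries ρ (fracLattice ρ m)).val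
    (prod_sub_smul_eq_pow latticeM_le hind hp.monic hp.irreducible hroot x)
  rw [map_prod, map_pow, hcard] at hprod
  have hL := isLeast_prod Finset.univ fun (χ : annihilator (fracLattice ρ m) (latticeM ρ)) _ =>
    hf.isLeast_sub_smul_of_coincidence hm (x := x) rfl hj hxy χ.2 (hstab χ)
  rw [sum_contactExponent hind hle] at hL
  have hval : (convSeries ρ (fracLattice ρ m)).val
      ((p.map (baseInclusion latticeM_le)).eval x) = aeval ζ p := coe_eval_map latticeM_le p x
  rw [hval] at hprod
  obtain ⟨r, hr⟩ := Nat.exists_eq_succ_of_ne_zero hrelj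
  have hL' : IsLeast (aeval ζ p ^ (charLattice lam j).relIndex (fracLattice ρ m) :
      Series ρ).support ((charLattice lam j).relIndex (fracLattice ρ m) • gam lam (j + 1)) := by
    rw [← hprod]
    exact hL
  have hL'' := hL'
  rw [hr, pow_succ'] at hL''
  -- A factor of a monomial times a unit has a least exponent; it equals γ_{j+1} since both have the
  -- same positive multiple.
  obtain ⟨b, hb⟩ := exists_isLeast_of_mul hL''
  have := (isLeast_pow hb _).unique hL'
  rwa [← nsmul_right_injective hrelj this]

end IsBranch

end ToricQO

/-! ### Expansions in powers of monic polynomials -/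

namespace ToricQO

section Expansion

variable {R : Type*} [CommRing R] [Nontrivial R]

/-- The expansion of a polynomial in powers of a monic polynomial. -/
theorem exists_eq_sum_mul_pow {p : R[X]} (hp : p.Monic) (n : ℕ) {F : R[X]}
    (hF : F.degree < (n * p.natDegree : ℕ)) :
    ∃ c : ℕ → R[X], (∀ k, (c k).degree < p.natDegree) ∧
      F = ∑ k ∈ Finset.range n, c k * p ^ k := by
  have hlt : ∀ G : R[X], (G %ₘ p).degree < p.natDegree := fun G => by
    rw [← degree_eq_natDegree hp.ne_zero]
    exact degree_modByMonic_lt G hp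
  induction n generalizing F with
  | zero =>
    refine ⟨fun _ => 0 %ₘ p, fun _ => hlt 0, ?_⟩
    rw [zero_mul, Nat.cast_zero, Nat.WithBot.lt_zero_iff, degree_eq_bot] at hF
    simp [hF]
  | succ n ih =>
    have hdiv : (F /ₘ p).degree < (n * p.natDegree : ℕ) := by
      rcases eq_or_ne (F /ₘ p) 0 with h0 | h0
      · rw [h0, degree_zero]
        exact WithBot.bot_lt_coe _
      · have hF0 : F ≠ 0 := by
          rintro rfl
          exact h0 (zero_divByMonic p)
        rw [degree_eq_natDegree h0, natDegree_divByMonic F hp, Nat.cast_lt]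
        have h1 : p.degree ≤ F.degree := by
          by_contra h
          exact h0 ((divByMonic_eq_zero_iff hp).mpr (not_le.mp h))
        have h2 := natDegree_le_natDegree h1
        rw [degree_eq_natDegree hF0, Nat.cast_lt, add_mul, one_mul] at hF
        omega
    obtain ⟨c, hc, hsum⟩ := ih hdiv
    refine ⟨fun k => if k = 0 then F %ₘ p else c (k - 1), fun k => ?_, ?_⟩
    · dsimp only
      split_ifs
      · exact hlt F
      · exact hc _
    · rw [Finset.sum_range_succ']
      simp only [Nat.add_eq_zero_iff, one_ne_zero, and_false, if_false, Nat.add_sub_cancel, if_true,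
        pow_zero, mul_one]
      conv_lhs => rw [← modByMonic_add_div F p, hsum]
      rw [add_comm, Finset.mul_sum]
      congr 1
      exact Finset.sum_congr rfl fun k _ => by ring

/-- The expansion of a polynomial in terms of polynomials `q_0, …, q_{j-1}` each of whose degrees
divides the next one. -/
theorem exists_expansion {g : ℕ} (q : Fin g → R[X]) (n D : ℕ → ℕ) (hD0 : D 0 = 1)
    (hD : ∀ j, D (j + 1) = n j * D j)
    (hq : ∀ i : Fin g, ∃ (a : R) (p : R[X]), IsUnit a ∧ p.Monic ∧ p.natDegree = D i ∧
      q i = C a * p) {j : ℕ} (hj : j ≤ g) {F : R[X]} (hF : F.degree < D j) :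
    ∃ P : MvPolynomial (Fin g) R, MvPolynomial.aeval q P = F ∧
      ∀ v ∈ P.support, (∀ i : Fin g, i < j → v i < n i) ∧ ∀ i : Fin g, j ≤ i → v i = 0 := by
  classical
  induction j generalizing F with
  | zero =>
    rw [hD0, Nat.cast_one] at hF
    refine ⟨MvPolynomial.C (F.coeff 0), ?_, fun v hv => ⟨fun i hi => absurd hi (by omega),
      fun i _ => ?_⟩⟩
    · rw [MvPolynomial.aeval_C, eq_C_of_degree_le_zero (Nat.WithBot.lt_one_iff_le_zero.mp hF),
        coeff_C_zero]
      rfl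
    · by_contra hne
      rw [MvPolynomial.mem_support_iff, MvPolynomial.coeff_C] at hv
      split_ifs at hv with h
      · exact hne (by rw [← h]; rfl)
      · exact hv rfl
  | succ j ih =>
    let J : Fin g := ⟨j, hj⟩
    obtain ⟨a, p, ⟨a, rfl⟩, hp, hdeg, hqj⟩ := hq J
    rw [hD, show D j = p.natDegree from hdeg.symm] at hF
    obtain ⟨c, hc, hsum⟩ := exists_eq_sum_mul_pow hp (n j) hF
    -- Division uses the monic `p`, whereas the expansion is in q_j = a p; the factor a^{-k} in the
    -- `k`-th coefficient compensates.
    have hPk : ∀ k, ∃ P : MvPolynomial (Fin g) R,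
        MvPolynomial.aeval q P = C ((↑a⁻¹ : R) ^ k) * c k ∧
        ∀ v ∈ P.support, (∀ i : Fin g, i < j → v i < n i) ∧ ∀ i : Fin g, j ≤ i → v i = 0 := by
      intro k
      refine ih (by omega) (lt_of_le_of_lt ?_ (hdeg ▸ hc k))
      rw [← smul_eq_C_mul]
      exact degree_smul_le _ _
    choose P hPa hPs using hPk
    refine ⟨∑ k ∈ Finset.range (n j), P k * MvPolynomial.X J ^ k, ?_, fun v hv => ?_⟩
    · rw [map_sum, hsum]
      refine Finset.sum_congr rfl fun k _ => ?_
      rw [map_mul, map_pow, MvPolynomial.aeval_X, hPa, hqj, mul_pow, ← C_pow]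
      have h1 : (C ((↑a⁻¹ : R) ^ k) * C ((a : R) ^ k) : R[X]) = 1 := by
        rw [← C_mul, ← mul_pow, Units.inv_mul, one_pow, C_1]
      linear_combination (c k * p ^ k) * h1
    · obtain ⟨k, hk, hv⟩ := Finset.mem_biUnion.mp (MvPolynomial.support_sum hv)
      obtain ⟨v', hv', s, hs, rfl⟩ := Finset.mem_add.mp (MvPolynomial.support_mul _ _ hv)
      rw [MvPolynomial.support_X_pow, Finset.mem_singleton] at hs
      subst hs
      obtain ⟨h1, h2⟩ := hPs k v' hv'
      have hk' := Finset.mem_range.mp hk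
      refine ⟨fun i hi => ?_, fun i hi => ?_⟩
      · rcases Nat.lt_succ_iff_lt_or_eq.mp hi with hi | hi
        · have hne : J ≠ i := fun h => by simp [← h, J] at hi
          simpa [Finsupp.single_eq_of_ne' hne] using h1 i hi
        · have he : i = J := Fin.ext hi
          subst he
          simpa [h2 J le_rfl] using hk'
      · have hne : J ≠ i := fun h => by simp [← h, J] at hi
        simpa [Finsupp.single_eq_of_ne' hne] using h2 i (by omega)

end Expansion

end ToricQO

/-! ### Initial terms of reduced polynomials in the values of the semi-roots -/

namespace ToricQO

variable {d : ℕ} {ρ : RationalCone d} {lam : ℕ → Expo ρ} {g : ℕ}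

theorem coeff_series_sum {ι : Type*} (s : Finset ι) (T : ι → Series ρ) (u : Expo ρ) :
    (∑ i ∈ s, T i).coeff u = ∑ i ∈ s, (T i).coeff u := by
  classical
  induction s using Finset.induction_on with
  | empty => rfl
  | insert i s hi ih => rw [Finset.sum_insert hi, Finset.sum_insert hi, HahnSeries.coeff_add, ih]

theorem aeval_eq_sum (P : MvPolynomial (Fin g) (BaseRing ρ)) (y : Fin g → Series ρ) :
    MvPolynomial.aeval y P = ∑ v ∈ P.support, ((P.coeff v : BaseRing ρ) : Series ρ) * ∏ i, y i ^ v i := by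
  rw [MvPolynomial.aeval_def, MvPolynomial.eval₂_eq']
  rfl

/-- The leading exponent of a reduced polynomial in series with leading exponents `γ_1, …, γ_g` is
the least weight of its terms. -/
theorem exists_isLeading_aeval {L : Type*} [AddCommGroup L] [LinearOrder L] [IsOrderedAddMonoid L]
    {φ : Expo ρ →+ L} (hinj : Function.Injective φ) (hmono : Monotone φ)
    {P : MvPolynomial (Fin g) (BaseRing ρ)} (hP0 : P ≠ 0)
    (hP : ∀ v ∈ P.support, ∀ i : Fin g, v i < charInt lam (i + 1)) {y : Fin g → Series ρ}
    (hy : ∀ i : Fin g, IsLeast (y i).support (gam lam (i + 1)))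
    (hy1 : ∀ i : Fin g, (y i).coeff (gam lam (i + 1)) = 1) :
    ∃ v α, IsLeading φ (MvPolynomial.aeval y P) (weight lam α v) ∧
      (MvPolynomial.aeval y P).coeff (weight lam α v) = ((P.coeff v : BaseRing ρ) : Series ρ).coeff α ∧
      ∀ v' α', ((P.coeff v' : BaseRing ρ) : Series ρ).coeff α' ≠ 0 → φ (weight lam α v) ≤ φ (weight lam α' v') := by
  classical
  let T : (Fin g →₀ ℕ) → Series ρ := fun v => ((P.coeff v : BaseRing ρ) : Series ρ) * ∏ i, y i ^ v i
  have hex : ∀ v, ∃ a, v ∈ P.support → IsLeading φ ((P.coeff v : BaseRing ρ) : Series ρ) a := by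
    intro v
    by_cases hv : v ∈ P.support
    · have h0 : ((P.coeff v : BaseRing ρ) : Series ρ) ≠ 0 := fun h =>
        (MvPolynomial.mem_support_iff.mp hv) (Subtype.ext h)
      obtain ⟨a, ha⟩ := exists_isLeading hmono h0
      exact ⟨a, fun _ => ha⟩
    · exact ⟨0, fun h => absurd h hv⟩
  choose a ha using hex
  have hprod : ∀ v : Fin g →₀ ℕ,
      IsLeast (∏ i, y i ^ v i).support (∑ i : Fin g, v i • gam lam (i + 1)) :=
    fun v => isLeast_prod _ fun i _ => isLeast_pow (hy i) _
  have hprod1 : ∀ v : Fin g →₀ ℕ,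
      (∏ i, y i ^ v i).coeff (∑ i : Fin g, v i • gam lam (i + 1)) = 1 := fun v => by
    rw [coeff_prod_of_isLeast _ fun i _ => isLeast_pow (hy i) _]
    exact Finset.prod_eq_one fun i _ => by rw [coeff_pow_of_isLeast (hy i), hy1, one_pow]
  have hT : ∀ v ∈ P.support, IsLeading φ (T v) (weight lam (a v) v) := fun v hv =>
    (ha v hv).mul hinj (isLeading_of_isLeast hmono (hprod v))
  obtain ⟨v, hv, hmin⟩ := Finset.exists_min_image P.support (fun v => φ (weight lam (a v) v))
    (MvPolynomial.support_nonempty.mpr hP0)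
  have hcoeff : (MvPolynomial.aeval y P).coeff (weight lam (a v) v) =
      ((P.coeff v : BaseRing ρ) : Series ρ).coeff (a v) := by
    rw [aeval_eq_sum, coeff_series_sum, Finset.sum_eq_single v]
    · have h1 := (ha v hv).coeff_mul hinj (isLeading_of_isLeast hmono (hprod v))
      rw [hprod1, mul_one] at h1
      exact h1
    -- Another summand contributing here would have a leading term of the same weight, which
    -- reducedness excludes. So the minimal term is not cancelled.
    · intro v' hv' hne
      by_contra hc
      have hw := hinj (le_antisymm ((hT v' hv').2 _ hc) (hmin v' hv'))
      exact hne (eq_of_weight_eq ((P.coeff v').2.1 _ (ha v' hv').1).2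
        ((P.coeff v).2.1 _ (ha v hv).1).2 (hP v' hv') (hP v hv) hw).1
    · exact fun h => absurd hv h
  refine ⟨v, a v, ⟨?_, fun u hu => ?_⟩, hcoeff, fun v' α' h' => ?_⟩
  · rw [hcoeff]
    exact (ha v hv).1
  · rw [aeval_eq_sum, coeff_series_sum] at hu
    obtain ⟨v', hv', hne⟩ := Finset.exists_ne_zero_of_sum_ne_zero hu
    exact (hmin v' hv').trans ((hT v' hv').2 u hne)
  · have hv' : v' ∈ P.support := MvPolynomial.mem_support_iff.mpr fun h0 => by
      rw [h0] at h'
      exact h' rfl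
    refine (hmin v' hv').trans ?_
    unfold weight
    rw [map_add, map_add]
    exact add_le_add_left ((ha v' hv').2 α' h') _

/-- For every linear refinement the minimal weight is `N`. Refinements starting with each `w` in the
cone turn this into an inequality for `≤_ρ`. -/
theorem terms_of_isLeast_aeval {P : MvPolynomial (Fin g) (BaseRing ρ)}
    (hP : ∀ v ∈ P.support, ∀ i : Fin g, v i < charInt lam (i + 1)) {y : Fin g → Series ρ}
    (hy : ∀ i : Fin g, IsLeast (y i).support (gam lam (i + 1)))
    (hy1 : ∀ i : Fin g, (y i).coeff (gam lam (i + 1)) = 1) {N : Expo ρ}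
    (hN : IsLeast (MvPolynomial.aeval y P).support N) :
    (∀ v α, ((P.coeff v : BaseRing ρ) : Series ρ).coeff α ≠ 0 → N ≤ weight lam α v) ∧
      ∃ v α, weight lam α v = N ∧
        ((P.coeff v : BaseRing ρ) : Series ρ).coeff α = (MvPolynomial.aeval y P).coeff N := by
  have hP0 : P ≠ 0 := by
    rintro rfl
    rw [map_zero] at hN
    exact hN.1 rfl
  constructor
  · intro v α h
    refine le_iff_pairing.mpr fun w hw => ?_
    obtain ⟨k, φ, hinj, hmono, hφ⟩ := exists_linear_refinement w hw
    obtain ⟨v₀, α₀, h1, -, h3⟩ := exists_isLeading_aeval hinj hmono hP0 hP hy hy1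
    rw [← h1.unique hinj (isLeading_of_isLeast hmono hN)]
    exact hφ _ _ (h3 v α h)
  · obtain ⟨k, φ, hinj, hmono, -⟩ := exists_linear_refinement (ρ := ρ) 0 ρ.cone.zero_mem
    obtain ⟨v₀, α₀, h1, h2, -⟩ := exists_isLeading_aeval hinj hmono hP0 hP hy hy1
    have hw := h1.unique hinj (isLeading_of_isLeast hmono hN)
    exact ⟨v₀, α₀, hw, by rw [← h2, hw]⟩

end ToricQO

/-! ### The relations between consecutive semi-roots -/

namespace ToricQO

variable {d : ℕ} {ρ : RationalCone d} {f : (BaseRing ρ)[X]} {ζ : Series ρ} {g : ℕ}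
  {lam : ℕ → Expo ρ} {q : Fin (g + 1) → (BaseRing ρ)[X]}

theorem coe_algebraMap_complex (a : ℂ) :
    ((algebraMap ℂ (BaseRing ρ) a : BaseRing ρ) : Series ρ) = HahnSeries.single 0 a := rfl

theorem isLeast_support_C {a : ℂ} (ha : a ≠ 0) :
    IsLeast ((algebraMap ℂ (BaseRing ρ) a : BaseRing ρ) : Series ρ).support 0 := by
  rw [coe_algebraMap_complex, HahnSeries.support_single_of_ne ha]
  exact isLeast_singleton

theorem aeval_C_mul (a : BaseRing ρ) (p : (BaseRing ρ)[X]) (z : Series ρ) :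
    aeval z (C a * p) = (a : Series ρ) * aeval z p := by
  rw [map_mul, aeval_C]
  rfl

namespace IsBranch

theorem charInt_pos (hf : IsBranch f ζ g lam) {k : ℕ} (hk : k + 1 ≤ g) :
    0 < charInt lam (k + 1) := by
  have hle := hf.charLattice_le_fracLattice hf.natDegree_pos (x := ⟨ζ, hf.mem⟩) rfl hk
  have h := relIndex_latticeM_ne_zero (ρ := ρ) hf.natDegree_pos
  rw [← AddSubgroup.relIndex_mul_relIndex _ _ _ (latticeM_le_charLattice lam (k + 1)) hle,
    ← prod_charInt, Finset.prod_range_succ] at h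
  exact Nat.pos_of_ne_zero (right_ne_zero_of_mul (left_ne_zero_of_mul h))

theorem charInt_nsmul_gam_lt (hf : IsBranch f ζ g lam) {j : ℕ} (hj : j + 2 ≤ g) :
    charInt lam (j + 1) • gam lam (j + 1) < gam lam (j + 2) := by
  rw [gam_succ_succ, add_sub_assoc]
  exact lt_add_of_pos_right _ (sub_pos.mpr
    (hf.strictMono ⟨by omega, by omega⟩ ⟨by omega, hj⟩ (by omega)))

theorem dvd_of_aeval_eq_zero (hf : IsBranch f ζ g lam) {Q : (BaseRing ρ)[X]}
    (hQ : aeval ζ Q = 0) : f ∣ Q := by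
  have hind := relIndex_latticeM_ne_zero (ρ := ρ) hf.natDegree_pos
  have := finite_annihilator hind
  have := Fintype.ofFinite (annihilator (fracLattice ρ f.natDegree) (latticeM ρ))
  exact ToricQO.dvd_of_aeval_eq_zero latticeM_le hind hf.monic hf.irreducible
    (x := ⟨ζ, hf.mem⟩) hf.root hQ

end IsBranch

namespace IsNormalizedSemiRoots

theorem exists_last (hq : IsNormalizedSemiRoots f ζ g lam q) :
    ∃ a : ℂ, a ≠ 0 ∧ q (Fin.last g) = C (algebraMap ℂ (BaseRing ρ) a) * f := by
  obtain ⟨a, p, ha, hp, h⟩ := hq.semiRoot (Fin.last g)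
  have hco := hp.coincidence
  rw [Fin.val_last, if_neg (by omega)] at hco
  have hpf : p = f := hco
  exact ⟨a, ha, hpf ▸ h⟩

theorem isLeast_aeval (hq : IsNormalizedSemiRoots f ζ g lam q) (hf : IsBranch f ζ g lam)
    (j : Fin g) : IsLeast (aeval ζ (q j.castSucc) : Series ρ).support (gam lam (j + 1)) := by
  obtain ⟨a, p, ha, hp, h⟩ := hq.semiRoot j.castSucc
  rw [h, aeval_C_mul]
  simpa using isLeast_mul (isLeast_support_C ha) (hf.isLeast_aeval_semiRoot j.2 hp)

/-- For an intermediate semi-root the least exponent is the next γ, which exceeds n_jγ_j. The last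
semi-root vanishes at ζ, so there it has no exponents at all. -/
theorem lt_of_coeff_aeval_succ_ne_zero (hq : IsNormalizedSemiRoots f ζ g lam q)
    (hf : IsBranch f ζ g lam) (j : Fin g) {u : Expo ρ}
    (hu : (aeval ζ (q j.succ) : Series ρ).coeff u ≠ 0) :
    charInt lam (j + 1) • gam lam (j + 1) < u := by
  rcases lt_or_ge ((j : ℕ) + 1) g with h | h
  · exact (hf.charInt_nsmul_gam_lt h).trans_le ((hq.isLeast_aeval hf ⟨j + 1, h⟩).2 hu)
  · have hlast : j.succ = Fin.last g := Fin.ext (by have := j.2; simp; omega)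
    obtain ⟨a, -, ha⟩ := hq.exists_last
    rw [hlast, ha, aeval_C_mul, hf.root, mul_zero] at hu
    exact absurd rfl hu

/-- The remainder of the division of `q_{j-1}^{n_j}` by `q_j`. -/
theorem exists_remainder (hq : IsNormalizedSemiRoots f ζ g lam q) (j : Fin g) :
    ∃ c : ℂ, c ≠ 0 ∧ (q j.castSucc ^ charInt lam (j + 1) +
      C (algebraMap ℂ (BaseRing ρ) c) * q j.succ).degree <
        ((∏ k ∈ Finset.range (j + 1 + 1), charInt lam k : ℕ) : WithBot ℕ) := by
  obtain ⟨a, p, ha, hp, h⟩ := hq.semiRoot j.castSucc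
  obtain ⟨a', p', ha', hp', h'⟩ := hq.semiRoot j.succ
  -- The constant cancels the leading coefficients a^{n} and a' of two polynomials of the same
  -- degree.
  refine ⟨-(a ^ charInt lam (j + 1) / a'), neg_ne_zero.mpr (div_ne_zero (pow_ne_zero _ ha) ha'), ?_⟩
  have hF : q j.castSucc ^ charInt lam (j + 1) +
      C (algebraMap ℂ (BaseRing ρ) (-(a ^ charInt lam (j + 1) / a'))) * q j.succ =
      algebraMap ℂ (BaseRing ρ) (a ^ charInt lam (j + 1)) •
        (p ^ charInt lam (j + 1) - p') := by
    rw [h, h', mul_pow, ← C_pow, ← map_pow, ← mul_assoc, ← C_mul, ← map_mul, neg_mul,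
      div_mul_cancel₀ _ ha', map_neg, C_neg, smul_eq_C_mul]
    ring
  have hmon := hp.monic.pow (charInt lam (j + 1))
  have hdeg : (p ^ charInt lam (j + 1)).degree =
      ((∏ k ∈ Finset.range (j + 1 + 1), charInt lam k : ℕ) : WithBot ℕ) := by
    rw [degree_eq_natDegree hmon.ne_zero, hp.monic.natDegree_pow, hp.natDegree_eq,
      Finset.prod_range_succ _ ((j : ℕ) + 1), mul_comm]
    rfl
  have hdeg' : p'.degree = ((∏ k ∈ Finset.range (j + 1 + 1), charInt lam k : ℕ) : WithBot ℕ) := by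
    rw [degree_eq_natDegree hp'.monic.ne_zero, hp'.natDegree_eq]
    rfl
  rw [hF]
  refine (degree_smul_le _ _).trans_lt ?_
  rw [← hdeg]
  exact degree_sub_lt_left (hdeg.trans hdeg'.symm) hmon.ne_zero
    (hmon.leadingCoeff.trans hp'.monic.leadingCoeff.symm)

theorem exists_expansion (hq : IsNormalizedSemiRoots f ζ g lam q) {j : ℕ} (hj : j ≤ g)
    {F : (BaseRing ρ)[X]}
    (hF : F.degree < ((∏ k ∈ Finset.range (j + 1), charInt lam k : ℕ) : WithBot ℕ)) :
    ∃ P : MvPolynomial (Fin g) (BaseRing ρ),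
      MvPolynomial.aeval (fun i : Fin g => q i.castSucc) P = F ∧ ∀ v ∈ P.support,
        (∀ i : Fin g, i < j → v i < charInt lam (i + 1)) ∧ ∀ i : Fin g, j ≤ i → v i = 0 := by
  refine ToricQO.exists_expansion (fun i : Fin g => q i.castSucc) (fun i => charInt lam (i + 1))
    (fun j => ∏ k ∈ Finset.range (j + 1), charInt lam k) ?_ (fun j => ?_) (fun i => ?_) hj hF
  · simp [charInt]
  · rw [Finset.prod_range_succ, mul_comm]
  · obtain ⟨a, p, ha, hp, h⟩ := hq.semiRoot i.castSucc
    exact ⟨_, p, (IsUnit.mk0 a ha).map (algebraMap ℂ (BaseRing ρ)), hp.monic, hp.natDegree_eq, h⟩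

theorem aeval_aeval_eq (P : MvPolynomial (Fin g) (BaseRing ρ)) :
    aeval ζ (MvPolynomial.aeval (fun i : Fin g => q i.castSucc) P) =
      MvPolynomial.aeval (fun i : Fin g => (aeval ζ (q i.castSucc) : Series ρ)) P := by
  rw [← MvPolynomial.comp_aeval_apply]

/-- The expansion of `q_{j-1}^{n_j}` in terms of semi-roots. -/
theorem exists_relation (hq : IsNormalizedSemiRoots f ζ g lam q) (hf : IsBranch f ζ g lam)
    (j : Fin g) : ∃ (α : semigroup ρ (latticeM ρ)) (l : Fin g →₀ ℕ) (c : ℂ)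
      (r : MvPolynomial (Fin g) (BaseRing ρ)),
      ((∀ i, j ≤ i → l i = 0) ∧ (∀ i, i < j → l i < charInt lam (i + 1)) ∧
        charInt lam (j + 1) • gam lam (j + 1) = weight lam (α : Expo ρ) l) ∧ c ≠ 0 ∧
      (∀ v ∈ r.support, (∀ i, j < i → v i = 0) ∧ ∀ i, i ≤ j → v i < charInt lam (i + 1)) ∧
      TermsWeightGT lam r (charInt lam (j + 1) • gam lam (j + 1)) ∧
      q j.castSucc ^ charInt lam (j + 1) =
        MvPolynomial.aeval (fun i : Fin g => q i.castSucc)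
            (MvPolynomial.monomial l (toricMonomial α))
          - C (algebraMap ℂ (BaseRing ρ) c) * q j.succ
          - MvPolynomial.aeval (fun i : Fin g => q i.castSucc) r := by
  classical
  set N := charInt lam (j + 1) • gam lam (j + 1) with hNdef
  obtain ⟨c, hc, hdeg⟩ := hq.exists_remainder j
  obtain ⟨P, hPF, hPs⟩ := hq.exists_expansion (j := j + 1) j.2 hdeg
  have hred : ∀ v ∈ P.support, ∀ i : Fin g, v i < charInt lam (i + 1) := by
    intro v hv i
    rcases lt_or_ge (i : ℕ) (j + 1) with h | h
    · exact (hPs v hv).1 i h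
    · rw [(hPs v hv).2 i h]
      exact hf.charInt_pos i.2
  have hy := hq.isLeast_aeval hf
  have hy1 := hq.normalized
  have hval : MvPolynomial.aeval (fun i : Fin g => (aeval ζ (q i.castSucc) : Series ρ)) P =
      aeval ζ (q j.castSucc) ^ charInt lam (j + 1) +
        ((algebraMap ℂ (BaseRing ρ) c : BaseRing ρ) : Series ρ) * aeval ζ (q j.succ) := by
    rw [← aeval_aeval_eq, hPF, map_add, aeval_C_mul, map_pow]
  -- The correction by the next semi-root only adds exponents greater than `N`, so the value of `P`
  -- keeps the initial term X^N of the power.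
  have htail : ∀ u, (((algebraMap ℂ (BaseRing ρ) c : BaseRing ρ) : Series ρ) *
      aeval ζ (q j.succ)).coeff u ≠ 0 → N < u := by
    intro u hu
    rw [coe_algebraMap_complex, HahnSeries.coeff_single_zero_mul] at hu
    exact hq.lt_of_coeff_aeval_succ_ne_zero hf j (right_ne_zero_of_mul hu)
  have hpow := isLeast_pow (hy j) (charInt lam (j + 1))
  have hN1 : (MvPolynomial.aeval (fun i : Fin g => (aeval ζ (q i.castSucc) : Series ρ)) P).coeff N
      = 1 := by
    rw [hval, HahnSeries.coeff_add, hNdef, coeff_pow_of_isLeast (hy j), hy1, one_pow]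
    by_contra hne
    exact (htail N fun h => hne (by rw [← hNdef, h, add_zero])).false
  have hN : IsLeast
      (MvPolynomial.aeval (fun i : Fin g => (aeval ζ (q i.castSucc) : Series ρ)) P).support N := by
    refine ⟨?_, fun u hu => ?_⟩
    · rw [HahnSeries.mem_support, hN1]
      exact one_ne_zero
    · rw [hval] at hu
      rcases HahnSeries.support_add_subset _ _ hu with h | h
      · exact hpow.2 h
      · exact (htail u h).le
  obtain ⟨hge, l, α, hw, hcoef⟩ := terms_of_isLeast_aeval hred hy hy1 hN
  rw [hN1] at hcoef
  have hαl : ((P.coeff l : BaseRing ρ) : Series ρ).coeff α ≠ 0 := by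
    rw [hcoef]
    exact one_ne_zero
  have hl : l ∈ P.support := MvPolynomial.mem_support_iff.mpr fun h0 => by
    rw [h0] at hαl
    exact hαl rfl
  have hα := (P.coeff l).2.1 α hαl
  -- Since `N` and all other summands of the weight lie in `charLattice lam j`, so does l_j times
  -- the generator; then the charInt of this step divides l_j, which is smaller.
  have hlj : l j = 0 := by
    have hM : charInt lam (j + 1) • gam lam (j + 1) ∈ charLattice lam j :=
      charInt_nsmul_mem (gam_mem_charLattice lam j)
    rw [← hNdef, ← hw] at hM
    unfold weight at hM
    rw [← Finset.add_sum_erase _ _ (Finset.mem_univ j)] at hM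
    have hrest : ∑ i ∈ Finset.univ.erase j, l i • gam lam (i + 1) ∈ charLattice lam j := by
      refine sum_mem fun i hi => ?_
      rcases lt_or_ge (i : ℕ) (j + 1) with h | h
      · have hne : (i : ℕ) ≠ j := fun h => Finset.ne_of_mem_erase hi (Fin.ext h)
        exact nsmul_mem (charLattice_mono lam (by omega) (gam_mem_charLattice lam i)) _
      · rw [(hPs l hl).2 i h, zero_smul]
        exact zero_mem _
    have hj : (l j : ℤ) • gam lam (j + 1) ∈ charLattice lam j := by
      have := sub_mem (sub_mem hM (latticeM_le_charLattice lam j hα.2)) hrest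
      rw [add_sub_cancel_left, add_sub_cancel_right] at this
      rwa [natCast_zsmul]
    have hdvd := Int.natCast_dvd_natCast.mp (charInt_dvd_of_zsmul_gam_mem hj)
    exact Nat.eq_zero_of_dvd_of_lt hdvd (hred l hl j)
  have hsupp : ∀ v ∈ (MvPolynomial.monomial l (toricMonomial ⟨α, hα⟩) - P).support,
      v ∈ P.support := by
    intro v hv
    rcases Finset.mem_union.mp (MvPolynomial.support_sub _ _ _ hv) with h | h
    · rw [Finset.mem_singleton.mp (MvPolynomial.support_monomial_subset h)]
      exact hl
    · exact h
  -- The remainder `r` is minus `P` deprived of its single term of weight `N`, whose coefficient is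
  -- one thanks to the normalization.
  refine ⟨⟨α, hα⟩, l, c, MvPolynomial.monomial l (toricMonomial ⟨α, hα⟩) - P,
    ⟨fun i hi => ?_, fun i _ => hred l hl i, hw.symm⟩, hc,
    fun v hv => ⟨fun i hi => (hPs v (hsupp v hv)).2 i hi, fun i _ => hred v (hsupp v hv) i⟩, ?_, ?_⟩
  · rcases hi.eq_or_lt with rfl | hi
    · exact hlj
    · exact (hPs l hl).2 i hi
  · intro v β hβ
    have hv : v ∈ P.support := hsupp v (MvPolynomial.mem_support_iff.mpr fun h0 => by
      rw [h0] at hβ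
      exact hβ rfl)
    have hβM := ((MvPolynomial.monomial l (toricMonomial ⟨α, hα⟩) - P).coeff v).2.1 β hβ
    have hcβ : (((MvPolynomial.monomial l (toricMonomial ⟨α, hα⟩) - P).coeff v : BaseRing ρ) :
        Series ρ).coeff β = (((MvPolynomial.monomial l (toricMonomial ⟨α, hα⟩)).coeff v :
          BaseRing ρ) : Series ρ).coeff β - ((P.coeff v : BaseRing ρ) : Series ρ).coeff β := by
      rw [MvPolynomial.coeff_sub]
      rfl
    rw [hcβ, MvPolynomial.coeff_monomial] at hβ
    by_cases heq : l = v ∧ α = β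
    · obtain ⟨rfl, rfl⟩ := heq
      rw [if_pos rfl, hcoef] at hβ
      change (HahnSeries.single α (1 : ℂ) : Series ρ).coeff α - 1 ≠ 0 at hβ
      rw [HahnSeries.coeff_single_same, sub_self] at hβ
      exact absurd rfl hβ
    · have hzero : (((if l = v then toricMonomial ⟨α, hα⟩ else 0 : BaseRing ρ)) :
          Series ρ).coeff β = 0 := by
        split_ifs with h
        · exact HahnSeries.coeff_single_of_ne fun h' => heq ⟨h, h'.symm⟩
        · rfl
      rw [hzero, zero_sub, neg_ne_zero] at hβ
      -- Another term of weight `N` would be the same reduced monomial.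
      refine lt_of_le_of_ne (hge v β hβ) fun h => heq ?_
      exact eq_of_weight_eq hα.2 hβM.2 (hred l hl) (hred v hv) (hw.trans h)
  · rw [map_sub, hPF]
    ring

end IsNormalizedSemiRoots

end ToricQO

/-! ### Surjectivity and the kernel of the embedding homomorphism -/

namespace ToricQO

variable {d : ℕ} {ρ : RationalCone d} {f : (BaseRing ρ)[X]} {ζ : Series ρ} {g : ℕ}
  {lam : ℕ → Expo ρ} {q : Fin (g + 1) → (BaseRing ρ)[X]}

theorem aeval_congr_of_support {R B σ : Type*} [CommRing R] [CommRing B] [Algebra R B]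
    {F F' : σ → B} {P : MvPolynomial σ R}
    (h : ∀ v ∈ P.support, ∀ i, v i ≠ 0 → F i = F' i) :
    MvPolynomial.aeval F P = MvPolynomial.aeval F' P := by
  rw [MvPolynomial.aeval_def, MvPolynomial.aeval_def, MvPolynomial.eval₂_eq, MvPolynomial.eval₂_eq]
  refine Finset.sum_congr rfl fun v hv => ?_
  congr 1
  exact Finset.prod_congr rfl fun i hi => by rw [h v hv i (Finsupp.mem_support_iff.mp hi)]

theorem coe_embeddingHom (P : MvPolynomial (Fin g) (BaseRing ρ)) :
    (embeddingHom ζ q P : Series ρ) =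
      aeval ζ (MvPolynomial.aeval (fun i : Fin g => q i.castSucc) P) := by
  rw [IsNormalizedSemiRoots.aeval_aeval_eq]
  exact MvPolynomial.comp_aeval_apply _ (branchAlgebra ζ).val P

theorem termsWeightGT_linearTerm (hf : IsBranch f ζ g lam) (j : Fin g) (c : ℂ) :
    TermsWeightGT lam (linearTerm (ρ := ρ) j c) (charInt lam (j + 1) • gam lam (j + 1)) := by
  classical
  intro v α h
  unfold linearTerm at h
  split_ifs at h with hj
  · rw [MvPolynomial.coeff_C_mul, MvPolynomial.coeff_X] at h
    split_ifs at h with hv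
    · rw [mul_one, coe_algebraMap_complex] at h
      have hα : α = 0 := by
        by_contra hne
        exact h (HahnSeries.coeff_single_of_ne hne)
      subst hv hα
      have hw : weight lam (0 : Expo ρ) (Finsupp.single (⟨j + 1, hj⟩ : Fin g) 1) =
          gam lam (j + 2) := by
        unfold weight
        rw [zero_add, Finset.sum_eq_single ⟨j + 1, hj⟩]
        · rw [Finsupp.single_eq_same, one_smul]
        · intro i _ hi
          rw [Finsupp.single_eq_of_ne hi, zero_smul]
        · exact fun h => absurd (Finset.mem_univ _) h
      rw [hw]
      exact hf.charInt_nsmul_gam_lt hj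
    · rw [mul_zero] at h
      exact absurd rfl h
  · exact absurd rfl h

theorem TermsWeightGT.add {P Q : MvPolynomial (Fin g) (BaseRing ρ)} {w : Expo ρ}
    (hP : TermsWeightGT lam P w) (hQ : TermsWeightGT lam Q w) : TermsWeightGT lam (P + Q) w := by
  intro v α h
  by_cases h1 : ((P.coeff v : BaseRing ρ) : Series ρ).coeff α = 0
  · refine hQ v α fun h2 => h ?_
    rw [MvPolynomial.coeff_add]
    change ((P.coeff v : BaseRing ρ) : Series ρ).coeff α +
      ((Q.coeff v : BaseRing ρ) : Series ρ).coeff α = 0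
    rw [h1, h2, add_zero]
  · exact hP v α h1

/-- The variable `Y` as a polynomial in `U_1`, in view of the semi-root of degree one. -/
theorem exists_coordinate (hg : 1 ≤ g) (hq : IsNormalizedSemiRoots f ζ g lam q) :
    ∃ t : MvPolynomial (Fin g) (BaseRing ρ),
      MvPolynomial.aeval (fun i : Fin g => q i.castSucc) t = X ∧
      aeval t (q 0) = MvPolynomial.X ⟨0, hg⟩ := by
  obtain ⟨a, p, ha, hp, h⟩ := hq.semiRoot 0
  have hdeg : p.natDegree = 1 := by
    rw [hp.natDegree_eq]
    simp [charInt]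
  have hpX : p = X + C (p.coeff 0) := hp.monic.eq_X_add_C hdeg
  have haa : algebraMap ℂ (BaseRing ρ) a⁻¹ * algebraMap ℂ (BaseRing ρ) a = 1 := by
    rw [← map_mul, inv_mul_cancel₀ ha, map_one]
  have hq0 : q 0 = C (algebraMap ℂ (BaseRing ρ) a) * (X + C (p.coeff 0)) := by rw [← hpX, h]
  refine ⟨MvPolynomial.C (algebraMap ℂ (BaseRing ρ) a⁻¹) * MvPolynomial.X ⟨0, hg⟩ -
    MvPolynomial.C (p.coeff 0), ?_, ?_⟩
  · have h0 : q (Fin.castSucc ⟨0, hg⟩) = q 0 := rfl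
    rw [map_sub, map_mul, MvPolynomial.aeval_X, h0, hq0, MvPolynomial.aeval_C,
      MvPolynomial.aeval_C]
    change C _ * _ - C (p.coeff 0) = X
    rw [← mul_assoc, ← C_mul, haa, C_1]
    ring
  · rw [hq0, map_mul, map_add, aeval_X, aeval_C, aeval_C, MvPolynomial.algebraMap_eq,
      sub_add_cancel, ← mul_assoc, ← map_mul, mul_comm (algebraMap ℂ (BaseRing ρ) a), haa,
      map_one, one_mul]

/-- The semi-root q_0 has degree one and unit leading coefficient, so ζ is already a polynomial in
q_0(ζ). -/
theorem embeddingHom_surjective (hg : 1 ≤ g) (hq : IsNormalizedSemiRoots f ζ g lam q) :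
    Function.Surjective (embeddingHom ζ q) := by
  obtain ⟨t, ht, -⟩ := exists_coordinate hg hq
  rintro ⟨z, hz⟩
  obtain ⟨Q, rfl⟩ := (Algebra.adjoin_singleton_eq_range_aeval (BaseRing ρ) ζ).le hz
  refine ⟨aeval t Q, Subtype.ext ?_⟩
  rw [coe_embeddingHom, ← Polynomial.aeval_algHom_apply, ht, aeval_X_left_apply]
  rfl

section Kernel

variable {α : Fin g → semigroup ρ (latticeM ρ)} {l : Fin g → Fin g →₀ ℕ} {c : Fin g → ℂ}
  {r : Fin g → MvPolynomial (Fin g) (BaseRing ρ)}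

/-- The polynomial `H_j`. -/
noncomputable def deformedBinom (lam : ℕ → Expo ρ) (α : Fin g → semigroup ρ (latticeM ρ))
    (l : Fin g → Fin g →₀ ℕ) (c : Fin g → ℂ) (r : Fin g → MvPolynomial (Fin g) (BaseRing ρ))
    (j : Fin g) : MvPolynomial (Fin g) (BaseRing ρ) :=
  binom lam j (α j) (l j) + linearTerm j (c j) + r j

/-- This is the expansion evaluated at ζ. For the last index the linear term is absent, in
accordance with q_g(ζ) = 0. -/
theorem deformedBinom_mem_ker (hf : IsBranch f ζ g lam) (hq : IsNormalizedSemiRoots f ζ g lam q)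
    {j : Fin g} (hrel : q j.castSucc ^ charInt lam (j + 1) =
      MvPolynomial.aeval (fun i : Fin g => q i.castSucc)
          (MvPolynomial.monomial (l j) (toricMonomial (α j)))
        - C (algebraMap ℂ (BaseRing ρ) (c j)) * q j.succ
        - MvPolynomial.aeval (fun i : Fin g => q i.castSucc) (r j)) :
    embeddingHom ζ q (deformedBinom lam α l c r j) = 0 := by
  refine Subtype.ext ?_
  rw [coe_embeddingHom]
  have hlin : aeval ζ (MvPolynomial.aeval (fun i : Fin g => q i.castSucc)
      (linearTerm (ρ := ρ) j (c j))) =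
      aeval ζ (C (algebraMap ℂ (BaseRing ρ) (c j)) * q j.succ) := by
    unfold linearTerm
    split_ifs with h
    · rw [map_mul, MvPolynomial.aeval_X, MvPolynomial.aeval_C]
      rfl
    · have hlast : j.succ = Fin.last g := Fin.ext (by have := j.2; simp; omega)
      obtain ⟨a, -, ha⟩ := hq.exists_last
      rw [hlast, ha, map_mul, map_mul _ _ f, hf.root, mul_zero, mul_zero, map_zero, map_zero]
  unfold deformedBinom binom
  rw [map_add, map_add, map_add, map_add, hlin, ← map_add, ← map_add, map_sub, map_pow,
    MvPolynomial.aeval_X, hrel]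
  ring_nf
  exact map_zero _

/-- Relations `q_j^{n_j} = m_j - c_j q_{j+1} - r_j`, with `m_j` and `r_j` polynomials in
`q_0, …, q_j`, allow to eliminate the variables `U_2, …, U_g`. -/
theorem mem_span_of_relations {R : Type*} [CommRing R] {g : ℕ} (hg : 1 ≤ g)
    {q : Fin (g + 1) → R[X]} {t : MvPolynomial (Fin g) R}
    (ht : aeval t (q 0) = MvPolynomial.X ⟨0, hg⟩) {n : Fin g → ℕ}
    {m r lin : Fin g → MvPolynomial (Fin g) R} {c : Fin g → R} (hc : ∀ j, IsUnit (c j))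
    (hlin : ∀ (j : Fin g) (h : (j : ℕ) + 1 < g),
      lin j = MvPolynomial.C (c j) * MvPolynomial.X ⟨j + 1, h⟩)
    (hlin' : ∀ j : Fin g, ¬ (j : ℕ) + 1 < g → lin j = 0)
    (hm : ∀ j, ∀ v ∈ (m j).support, ∀ i, j < i → v i = 0)
    (hr : ∀ j, ∀ v ∈ (r j).support, ∀ i, j < i → v i = 0)
    (hrel : ∀ j : Fin g, q j.castSucc ^ n j =
      MvPolynomial.aeval (fun i : Fin g => q i.castSucc) (m j) - C (c j) * q j.succ
        - MvPolynomial.aeval (fun i : Fin g => q i.castSucc) (r j))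
    {P : MvPolynomial (Fin g) R}
    (hP : q (Fin.last g) ∣ MvPolynomial.aeval (fun i : Fin g => q i.castSucc) P) :
    P ∈ Ideal.span (Set.range fun j => MvPolynomial.X j ^ n j - m j + lin j + r j) := by
  set I := Ideal.span (Set.range fun j => MvPolynomial.X j ^ n j - m j + lin j + r j) with hI
  let π := Ideal.Quotient.mkₐ R I
  -- The substitution Y ↦ t is a candidate inverse of U_{j+1} ↦ q_j modulo the ideal. It has to send
  -- each q_j to the class of U_{j+1}, and q_g to zero.
  let θ : R[X] →ₐ[R] MvPolynomial (Fin g) R ⧸ I := aeval (π t)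
  have hθ : ∀ P, θ (MvPolynomial.aeval (fun i : Fin g => q i.castSucc) P) =
      MvPolynomial.aeval (fun i : Fin g => θ (q i.castSucc)) P := fun P => by
    rw [← MvPolynomial.comp_aeval_apply]
  have hπ : ∀ P, MvPolynomial.aeval (fun i : Fin g => π (MvPolynomial.X i)) P = π P := fun P => by
    rw [← MvPolynomial.comp_aeval_apply, MvPolynomial.aeval_X_left_apply]
  have hunit : ∀ j, IsUnit (algebraMap R (MvPolynomial (Fin g) R ⧸ I) (c j)) := fun j =>
    (hc j).map (algebraMap R _)
  have hstep : ∀ j : Fin g, (∀ i ≤ j, θ (q i.castSucc) = π (MvPolynomial.X i)) →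
      algebraMap R _ (c j) * θ (q j.succ) = π (lin j) := by
    intro j hj
    have h1 := congrArg θ (hrel j)
    have hcongr : ∀ Q : MvPolynomial (Fin g) R, (∀ v ∈ Q.support, ∀ i, j < i → v i = 0) →
        MvPolynomial.aeval (fun i : Fin g => θ (q i.castSucc)) Q = π Q := by
      intro Q hQ
      rw [← hπ]
      refine aeval_congr_of_support fun v hv i hi => hj i ?_
      by_contra hlt
      exact hi (hQ v hv i (not_le.mp hlt))
    have hC : θ (C (c j)) = algebraMap R _ (c j) := aeval_C _ _
    rw [map_sub, map_sub, map_pow, map_mul, hθ, hθ, hcongr _ (hm j), hcongr _ (hr j), hC,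
      hj j le_rfl] at h1
    have h2 : π (MvPolynomial.X j ^ n j - m j + lin j + r j) = 0 :=
      Ideal.Quotient.eq_zero_iff_mem.mpr (Ideal.subset_span ⟨j, rfl⟩)
    rw [map_add, map_add, map_sub, map_pow] at h2
    -- The image of the relation and the vanishing of the generator differ only in the linear term,
    -- because `θ` is already known on the variables in `m j` and `r j`.
    linear_combination h1 - h2
  have hind : ∀ k (hk : k < g), θ (q (Fin.castSucc ⟨k, hk⟩)) = π (MvPolynomial.X ⟨k, hk⟩) := by
    intro k
    induction k using Nat.strong_induction_on with
    | _ k ih =>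
      intro hk
      rcases k with _ | k
      · change aeval (π t) (q 0) = _
        rw [Polynomial.aeval_algHom_apply, ht]
      · have h1 := hstep ⟨k, by omega⟩ fun i hi => ih i (Nat.lt_succ_of_le hi) i.2
        rw [hlin _ hk, map_mul] at h1
        exact (hunit _).mul_left_cancel h1
  -- At the last index the linear term is zero, and the unit `c` can be cancelled.
  have hlast : θ (q (Fin.last g)) = 0 := by
    have h1 := hstep ⟨g - 1, by omega⟩ fun i _ => hind i i.2
    have hs : (⟨g - 1, by omega⟩ : Fin g).succ = Fin.last g := Fin.ext (by simp; omega)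
    rwa [hlin' _ (by simp; omega), map_zero, (hunit _).mul_right_eq_zero, hs] at h1
  obtain ⟨Q, hQ⟩ := hP
  have h1 := hθ P
  rw [hQ, map_mul, hlast, zero_mul] at h1
  refine Ideal.Quotient.eq_zero_iff_mem.mp ?_
  change π P = 0
  rw [← hπ, h1]
  exact congrArg (fun F => MvPolynomial.aeval F P) (funext fun i => (hind i i.2).symm)

/-- An element of the kernel becomes, after substituting the q_j, a polynomial vanishing at ζ. It is
divisible by `f`, hence by q_g, and the elimination applies. -/
theorem ker_embeddingHom_le (hg : 1 ≤ g) (hf : IsBranch f ζ g lam)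
    (hq : IsNormalizedSemiRoots f ζ g lam q) (hc : ∀ j, c j ≠ 0)
    (hl : ∀ j i, j ≤ i → l j i = 0) (hr : ∀ j, ∀ v ∈ (r j).support, ∀ i, j < i → v i = 0)
    (hrel : ∀ j : Fin g, q j.castSucc ^ charInt lam (j + 1) =
      MvPolynomial.aeval (fun i : Fin g => q i.castSucc)
          (MvPolynomial.monomial (l j) (toricMonomial (α j)))
        - C (algebraMap ℂ (BaseRing ρ) (c j)) * q j.succ
        - MvPolynomial.aeval (fun i : Fin g => q i.castSucc) (r j)) :
    RingHom.ker (embeddingHom ζ q) ≤ Ideal.span (Set.range (deformedBinom lam α l c r)) := by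
  obtain ⟨t, -, ht⟩ := exists_coordinate hg hq
  intro P hP
  have hzero : aeval ζ (MvPolynomial.aeval (fun i : Fin g => q i.castSucc) P) = 0 := by
    rw [← coe_embeddingHom, (RingHom.mem_ker).mp hP]
    rfl
  refine mem_span_of_relations hg ht (n := fun j => charInt lam (j + 1))
    (m := fun j => MvPolynomial.monomial (l j) (toricMonomial (α j))) (r := r)
    (lin := fun j => linearTerm j (c j)) (c := fun j => algebraMap ℂ (BaseRing ρ) (c j))
    (fun j => (IsUnit.mk0 _ (hc j)).map _) (fun j h => dif_pos h) (fun j h => dif_neg h)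
    (fun j v hv i hi => ?_) hr hrel ?_
  · rw [Finset.mem_singleton.mp (MvPolynomial.support_monomial_subset hv)]
    exact hl j i hi.le
  · obtain ⟨a, ha, hqa⟩ := hq.exists_last
    have hu : IsUnit (C (algebraMap ℂ (BaseRing ρ) a)) :=
      ((IsUnit.mk0 a ha).map (algebraMap ℂ (BaseRing ρ))).map C
    rw [hqa, hu.mul_left_dvd]
    exact hf.dvd_of_aeval_eq_zero hzero

end Kernel

end ToricQO

theorem mainTheorem9 {d : ℕ} (ρ : ToricQO.RationalCone d)
    (f : Polynomial (ToricQO.BaseRing ρ)) (ζ : ToricQO.Series ρ)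
    (g : ℕ) (hg : 1 ≤ g) (lam : ℕ → ToricQO.Expo ρ)
    (hf : ToricQO.IsBranch f ζ g lam)
    (q : Fin (g + 1) → Polynomial (ToricQO.BaseRing ρ))
    (hq : ToricQO.IsNormalizedSemiRoots f ζ g lam q) :
    Function.Surjective (ToricQO.embeddingHom ζ q) ∧
    ∃ (α : Fin g → ToricQO.semigroup ρ (ToricQO.latticeM ρ)) (l : Fin g → Fin g →₀ ℕ)
      (c : Fin g → ℂ) (r H : Fin g → MvPolynomial (Fin g) (ToricQO.BaseRing ρ)),
      -- the relations `n_j γ_j = α^(j) + l_1^(j) γ_1 + ⋯ + l_{j-1}^(j) γ_{j-1}`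
      (∀ j : Fin g,
        (∀ i, j ≤ i → l j i = 0) ∧ (∀ i, i < j → l j i < ToricQO.charInt lam (i + 1)) ∧
        ToricQO.charInt lam (j + 1) • ToricQO.gam lam (j + 1) =
          ToricQO.weight lam (α j : ToricQO.Expo ρ) (l j)) ∧
      -- the shape of the `H_j`
      (∀ j : Fin g, c j ≠ 0 ∧
        H j = ToricQO.binom lam j (α j) (l j) + ToricQO.linearTerm j (c j) + r j) ∧
      -- `r_j` is a polynomial in `U_1, …, U_j`, of degree `< n_i` in `U_i`
      (∀ j : Fin g, ∀ v ∈ (r j).support,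
        (∀ i, j < i → v i = 0) ∧ (∀ i, i ≤ j → v i < ToricQO.charInt lam (i + 1))) ∧
      -- the terms of `r_j`, and those of `H_j - h_j`, have weight `> n_j γ_j`
      (∀ j : Fin g,
        ToricQO.TermsWeightGT lam (r j)
          (ToricQO.charInt lam (j + 1) • ToricQO.gam lam (j + 1)) ∧
        ToricQO.TermsWeightGT lam (H j - ToricQO.binom lam j (α j) (l j))
          (ToricQO.charInt lam (j + 1) • ToricQO.gam lam (j + 1))) ∧
      -- the terms of `r_j` are given by the expansion of `q_{j-1}^{n_j}` in terms of semi-roots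
      (∀ j : Fin g,
        q j.castSucc ^ ToricQO.charInt lam (j + 1) =
          MvPolynomial.aeval (fun i : Fin g => q i.castSucc)
              (MvPolynomial.monomial (l j) (ToricQO.toricMonomial (α j)))
            - Polynomial.C (algebraMap ℂ (ToricQO.BaseRing ρ) (c j)) * q j.succ
            - MvPolynomial.aeval (fun i : Fin g => q i.castSucc) (r j)) ∧
      -- the ideal of the embedding is generated by the `H_j`
      RingHom.ker (ToricQO.embeddingHom ζ q) = Ideal.span (Set.range H) := by
  refine ⟨ToricQO.embeddingHom_surjective hg hq, ?_⟩
  choose α l c r hl hc hr hw hrel using fun j => hq.exists_relation hf j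
  refine ⟨α, l, c, r, ToricQO.deformedBinom lam α l c r, hl, fun j => ⟨hc j, rfl⟩, hr,
    fun j => ⟨hw j, ?_⟩, hrel, le_antisymm
      (ToricQO.ker_embeddingHom_le hg hf hq hc (fun j => (hl j).1)
        (fun j v hv => (hr j v hv).1) hrel) ?_⟩
  · have h : ToricQO.deformedBinom lam α l c r j - ToricQO.binom lam j (α j) (l j) =
        ToricQO.linearTerm j (c j) + r j := by
      unfold ToricQO.deformedBinom
      ring
    rw [h]
    exact (ToricQO.termsWeightGT_linearTerm hf j (c j)).add (hw j)
  · rw [Ideal.span_le]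
    rintro _ ⟨j, rfl⟩
    exact ToricQO.deformedBinom_mem_ker hf hq (hrel j)
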